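/- Let $m\ge 2$, $0\le k<n$ and $0\le s\le n\le m$ be integers and let $\lambda_s,\lambda_e>0$. Consider a source and $m$ receiver nodes, a fixed set $\mathcal S$ of $s$ of which are subscribers (scalable homogeneous network, memory scheme; partial key subscription is the case $s<n<m$). The source is updated at the times $\tau_1<\tau_2<\cdots$ of a Poisson process of rate $\lambda_s$, with counter $N_0(t)$. At time $\tau_\ell$ the source sends $n$ distinct keys of version $\ell$, one to each node of $\mathcal K^\ell=\mathcal S\cup\mathcal M^\ell$, where $\mathcal M^\ell$ is a uniformly random set of $n-s$ nonsubscribers, drawn independently for each $\ell$. Every ordered pair $(i,j)$ of distinct receivers is an edge, activated at the times of a Poisson process of rate $\lambda_e/(m-1)$; all these processes and the selections are mutually independent. When the edge $(i,j)$ is activated, node $i$ sends to node $j$ all keys that $i$ has received directly from the source since the previous activation of that edge; keys received from other receivers are not forwarded. A node can decrypt version $\ell$ once it has $k+1$ distinct keys of version $\ell$. Let $N_j^k(t)$ be the latest version that node $j$ can decrypt at time $t$ (with $N_j^k(t)=0$ if there is none), let $A_j(k,t)=N_0(t)-N_j^k(t)$ be the $k$-keys version age of node $j$, and call $\lim_{t\to\infty}\frac1t\int_0^t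 A_j(k,u)\,du$ the version age of $k$-keys of node $j$. Then there are constants $\Delta$ and $\Delta^\dagger$ such that, with probability $1$, this limit exists and equals $\Delta$ for every subscriber $j$ and equals $\Delta^\dagger$ for every nonsubscriber $j$, and the average version age over the graph, $\Delta_{\vec G}=\frac{s}{m}\Delta+\frac{m-s}{m}\Delta^\dagger$, satisfies $$\tilde\lambda\sum_{i=m-k}^{m-1}\frac1i\;\le\;\Delta_{\vec G}\;\le\;\tilde\lambda\sum_{i=n-k}^{n}\frac1i,\qquad \tilde\lambda=\frac{(m-1)\lambda_s}{\lambda_e}.$$ -/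

import Mathlib

open MeasureTheory ProbabilityTheory Filter Topology
open scoped NNReal

/-- `N` is a Poisson counter (homogeneous Poisson counting process) of rate `r`: it starts at `0`,
has nondecreasing right-continuous paths, and has independent Poisson increments. -/
structure IsPoissonCounter {Ω : Type*} [MeasurableSpace Ω] (N : ℝ≥0 → Ω → ℕ) (r : ℝ≥0)
    (μ : Measure Ω) : Prop where
  measurable : ∀ t, Measurable (N t)
  zero : ∀ ω, N 0 ω = 0
  monotone : ∀ ω, Monotone fun t => N t ω
  rightContinuous : ∀ ω t, ContinuousWithinAt (fun u => N u ω) (Set.Ici t) t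
  indepIncrements : HasIndepIncrements N μ
  law_increment : ∀ a b : ℝ≥0, a ≤ b →
    HasLaw (fun ω => N b ω - N a ω) (poissonMeasure (r * (b - a))) μ

/-- The directed edges between the `m` receiver nodes of the fully connected graph. -/
abbrev GossipEdge (m : ℕ) : Type := {e : Fin m × Fin m // e.1 ≠ e.2}

/-- The random inputs of a scalable homogeneous network with `m` receiver nodes (the elements of
`Fin m`), `n` keys per status update, set `S` of subscriber nodes, source update rate `lamS` and
gossip rate `lamE`.

* `cycle l` is the length of the `l`-th version cycle. The source updates form a Poisson process of
  rate `lamS`, that is, the cycle lengths are i.i.d. exponential.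
* `selected l` is the set of nonsubscriber nodes which are given the remaining `n - |S|` keys of
  version `l`; it is drawn uniformly at random, independently for each version.
* `activations e t` is the number of activations of the edge `e` in the time interval `[0, t]`;
  these counters are independent Poisson counters of rate `lamE / (m - 1)`.

The source updates, the selections and the edge activations are independent of each other. -/
structure HomogeneousNetwork {Ω : Type*} [MeasurableSpace Ω] (μ : Measure Ω) (m n : ℕ)
    (S : Finset (Fin m)) (lamS lamE : ℝ) where
  cycle : ℕ → Ω → ℝ
  selected : ℕ → Ω → Finset (Fin m)
  activations : GossipEdge m → ℝ≥0 → Ω → ℕ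
  measurable_cycle : ∀ l, Measurable (cycle l)
  law_cycle : ∀ l, HasLaw (cycle l) (expMeasure lamS) μ
  indep_cycle : iIndepFun cycle μ
  measurable_selected : ∀ l, Measurable (selected l)
  law_selected : ∀ l, HasLaw (selected l)
    (uniformOn {A : Finset (Fin m) | A ⊆ Sᶜ ∧ A.card = n - S.card}) μ
  indep_selected : iIndepFun selected μ
  poisson_activations : ∀ e,
    IsPoissonCounter (activations e) (lamE / ((m : ℝ) - 1)).toNNReal μ
  indep_activations : iIndepFun (fun e ω t => activations e t ω) μ
  indep_cycle_selected : IndepFun (fun ω l => cycle l ω) (fun ω l => selected l ω) μ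
  indep_source_activations : IndepFun
    (fun ω => ((fun l => cycle l ω : ℕ → ℝ), (fun l => selected l ω : ℕ → Finset (Fin m))))
    (fun ω e t => activations e t ω) μ

namespace HomogeneousNetwork

variable {Ω : Type*} [MeasurableSpace Ω] {μ : Measure Ω} {m n : ℕ} {S : Finset (Fin m)}
  {lamS lamE : ℝ}

/-- The time of the `l`-th status update at the source, with `updateTime 0 = 0`. -/
def updateTime (G : HomogeneousNetwork μ m n S lamS lamE) (l : ℕ) (ω : Ω) : ℝ :=
  ∑ i ∈ Finset.range l, G.cycle i ω

/-- The version at the source at time `t`: the number of status updates in `(0, t]`. -/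
noncomputable def sourceVersion (G : HomogeneousNetwork μ m n S lamS lamE) (t : ℝ≥0) (ω : Ω) : ℕ :=
  Set.ncard {l : ℕ | 1 ≤ l ∧ G.updateTime l ω ≤ t}

/-- The nodes which receive a key of version `l` directly from the source: all subscribers and the
selected nonsubscribers. The keys are distinct, so that a key is identified by its version and by
the node that receives it from the source. -/
def keyHolders (G : HomogeneousNetwork μ m n S lamS lamE) (l : ℕ) (ω : Ω) : Finset (Fin m) :=
  S ∪ G.selected l ω

/-- In the memory scheme, node `j` has at time `t` the key of version `l` that the source gave to
node `i`. A node has its own key from the time of the update on. A key given to another node `i`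
reaches `j` at the first activation of the edge from `i` to `j` after the update, since at each
activation node `i` sends all keys which it received from the source since the last one. Nodes
forward no keys other than those they received from the source. -/
def HoldsKey (G : HomogeneousNetwork μ m n S lamS lamE) (j i : Fin m) (l : ℕ) (t : ℝ≥0) (ω : Ω) :
    Prop :=
  i ∈ G.keyHolders l ω ∧ G.updateTime l ω ≤ t ∧
    (i = j ∨ ∃ h : i ≠ j,
      G.activations ⟨(i, j), h⟩ (G.updateTime l ω).toNNReal ω < G.activations ⟨(i, j), h⟩ t ω)

/-- Node `j` has at least `k + 1` distinct keys of version `l` at time `t`. -/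
def CanDecrypt (G : HomogeneousNetwork μ m n S lamS lamE) (k : ℕ) (j : Fin m) (l : ℕ) (t : ℝ≥0)
    (ω : Ω) : Prop :=
  k + 1 ≤ Set.ncard {i : Fin m | G.HoldsKey j i l t ω}

/-- The latest version that node `j` can decrypt at time `t` (and `0`, the initial version, as long
as there is none). -/
noncomputable def nodeVersion (G : HomogeneousNetwork μ m n S lamS lamE) (k : ℕ) (j : Fin m)
    (t : ℝ≥0) (ω : Ω) : ℕ :=
  sSup {l : ℕ | G.CanDecrypt k j l t ω}

/-- The `k`-keys version age of node `j` at time `t`, in the memory scheme. -/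
noncomputable def versionAge (G : HomogeneousNetwork μ m n S lamS lamE) (k : ℕ) (j : Fin m)
    (t : ℝ≥0) (ω : Ω) : ℝ :=
  (G.sourceVersion t ω : ℝ) - (G.nodeVersion k j t ω : ℝ)

end HomogeneousNetwork

/-- The time average `lim (1 / T) ∫₀ᵀ A(u) du` as `T → ∞` exists and equals `a`. -/
def IsTimeAverage (A : ℝ≥0 → ℝ) (a : ℝ) : Prop :=
  (∀ T : ℝ, 0 ≤ T → IntervalIntegrable (fun u : ℝ => A u.toNNReal) volume 0 T) ∧
    Tendsto (fun T : ℝ => (1 / T) * ∫ u in (0 : ℝ)..T, A u.toNNReal) atTop (𝓝 a)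

/-- The average over `m` nodes of which `s` are subscribers, each with version age `dSub`, and
`m - s` are nonsubscribers, each with version age `dNon`. -/
noncomputable def graphAverageAge (s m : ℕ) (dSub dNon : ℝ) : ℝ :=
  (s : ℝ) / m * dSub + ((m : ℝ) - s) / m * dNon

/-! The age is counted version by version. The difference between the source version and the version
of node j is the number of versions l ≥ 1 already issued for which j can decrypt no version from l
on. So the integral of the age up to an update is a sum over l of the time during which version l
counts, cut off at that update. Seen from the l-th update, the uncut time is the functional `delay`
of the network shifted by l cycles. The network restarts at each update with the same law and
independently of its past (`NetworkData.measurePreserving_join`). These delays are therefore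
stationary with some mean E, and the time average of the age is E divided by the mean cycle length,
that is lamS * E (`NetworkData.IsAge.isTimeAverage`).

Delays of different versions overlap in time and are dependent, so a law of large numbers has to be
proved. A delay that outlasts d cycles forces some edge to stay silent during these d cycles, which
has probability geometric in d; the rest of the delay is controlled by the first activation after
the restart. Hence the mixed second moments exceed E² by at most a summable sequence in the lag
(`NetworkData.exists_summable_correlation`), and the cut-off costs only a bounded amount in mean.
Sums of n terms then have mean square deviation O(n), and Chebyshev's inequality along the squares,
together with monotonicity, gives almost sure convergence
(`MeasureTheory.ae_tendsto_div_of_correlation`).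

The bounds on E come from order statistics of exponential variables of rate r = lamE / (m - 1),
whose means are partial harmonic sums (`lintegral_activationTime`). To decrypt anything, j needs k
keys besides its own, hence k activations among its m - 1 incoming edges. Conversely, the keys of a
single version suffice: k activations out of n - 1 edges if j holds one of them itself, k + 1 out of
n otherwise. Both bounds hold for every node, hence for any average over nodes. Within each of the
two classes E does not depend on the node, since transposing two nodes of the same class preserves
the law (`NetworkData.lintegral_delay_eq`). -/

open scoped ENNReal

/-! ### Counting paths -/

/-- The paths of a counting process: nondecreasing right-continuous functions starting at `0`. -/
abbrev CountingPath : Type :=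
  {f : ℝ≥0 → ℕ // f 0 = 0 ∧ Monotone f ∧ ∀ t, ContinuousWithinAt f (Set.Ici t) t}

namespace CountingPath

instance : CoeFun CountingPath fun _ => ℝ≥0 → ℕ := ⟨Subtype.val⟩

@[simp] lemma map_zero (x : CountingPath) : x 0 = 0 := x.2.1

lemma monotone (x : CountingPath) : Monotone x := x.2.2.1

lemma rightContinuous (x : CountingPath) (t : ℝ≥0) : ContinuousWithinAt x (Set.Ici t) t :=
  x.2.2.2 t

lemma ext {x y : CountingPath} (h : ∀ t, x t = y t) : x = y := Subtype.ext (funext h)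

lemma measurable_coe : Measurable fun x : CountingPath => (x : ℝ≥0 → ℕ) := measurable_subtype_coe

lemma measurable_apply (t : ℝ≥0) : Measurable fun x : CountingPath => x t :=
  (measurable_pi_apply t).comp measurable_coe

lemma measurable_iff {α : Type*} [MeasurableSpace α] {f : α → CountingPath} :
    Measurable f ↔ ∀ t, Measurable fun a => f a t :=
  ⟨fun h t => (measurable_apply t).comp h,
    fun h => Measurable.subtype_mk (measurable_pi_lambda _ h)⟩

/-- Right-continuity makes evaluation jointly measurable: it is the limit of evaluations at the grid
points `a n t`, which lie strictly to the right of t and converge to it, and for each n only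
countably many grid points occur. -/
lemma measurable_eval : Measurable fun p : CountingPath × ℝ≥0 => p.1 p.2 := by
  let a : ℕ → ℝ≥0 → ℝ≥0 := fun n t => ((⌊((n : ℝ≥0) + 1) * t⌋₊ : ℝ≥0) + 1) / ((n : ℝ≥0) + 1)
  have hpos : ∀ n : ℕ, (0 : ℝ≥0) < (n : ℝ≥0) + 1 := fun n => by positivity
  have hlow : ∀ n t, t ≤ a n t := fun n t => by
    rw [le_div_iff₀ (hpos n), mul_comm]
    exact (Nat.lt_floor_add_one _).le
  have hup : ∀ n t, a n t ≤ t + 1 / ((n : ℝ≥0) + 1) := fun n t => by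
    have h := Nat.floor_le (show 0 ≤ ((n : ℝ≥0) + 1) * t by positivity)
    rw [div_le_iff₀ (hpos n), add_mul t, div_mul_cancel₀ _ (hpos n).ne', mul_comm t]
    exact add_le_add_left h 1
  have hlim : ∀ t, Tendsto (fun n => a n t) atTop (𝓝[≥] t) := fun t => by
    refine tendsto_nhdsWithin_iff.2 ⟨?_, Eventually.of_forall fun n => hlow n t⟩
    refine tendsto_of_tendsto_of_tendsto_of_le_of_le tendsto_const_nhds ?_
      (fun n => hlow n t) (fun n => hup n t)
    have := (tendsto_one_div_add_atTop_nhds_zero_nat (𝕜 := ℝ≥0)).const_add t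
    simpa using this
  have hmeas : ∀ n, Measurable fun p : CountingPath × ℝ≥0 => p.1 (a n p.2) := fun n => by
    have h1 : Measurable fun q : CountingPath × ℕ => q.1 (((q.2 : ℝ≥0) + 1) / ((n : ℝ≥0) + 1)) :=
      measurable_from_prod_countable_left fun k =>
        measurable_apply (((k : ℝ≥0) + 1) / ((n : ℝ≥0) + 1))
    have h2 : Measurable fun p : CountingPath × ℝ≥0 => (p.1, ⌊((n : ℝ≥0) + 1) * p.2⌋₊) :=
      measurable_fst.prodMk (Nat.measurable_floor.comp (measurable_snd.const_mul _))
    exact h1.comp h2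
  refine measurable_of_tendsto_metrizable hmeas ?_
  rw [tendsto_pi_nhds]
  intro p
  exact (p.1.rightContinuous p.2).tendsto.comp (hlim p.2)

lemma _root_.Measurable.countingPath_eval {α : Type*} [MeasurableSpace α] {f : α → CountingPath}
    {g : α → ℝ≥0} (hf : Measurable f) (hg : Measurable g) : Measurable fun a => f a (g a) :=
  measurable_eval.comp (hf.prodMk hg)

lemma measure_ext {μ ν : Measure CountingPath}
    (h : μ.map (fun x : CountingPath => (x : ℝ≥0 → ℕ))
      = ν.map (fun x : CountingPath => (x : ℝ≥0 → ℕ))) : μ = ν := by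
  ext s hs
  obtain ⟨t, ht, rfl⟩ := hs
  have h1 := congrArg (fun ρ => ρ t) h
  simp only [Measure.map_apply measurable_coe ht] at h1
  exact h1

/-- The path of the increments after time `T`. -/
def shift (T : ℝ≥0) (x : CountingPath) : CountingPath :=
  ⟨fun t => x (T + t) - x T, by simp, fun a b h => Nat.sub_le_sub_right (x.monotone (by gcongr)) _,
    fun t => by
      have h : ContinuousWithinAt (fun u => x (T + u)) (Set.Ici t) t :=
        (x.rightContinuous (T + t)).comp (by fun_prop) fun u hu => by
          simpa using hu
      exact (continuous_of_discreteTopology (f := fun k : ℕ => k - x T)).continuousAt.comp_continuousWithinAt h⟩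

/-- The path stopped at time `T`. -/
def stopAt (T : ℝ≥0) (x : CountingPath) : CountingPath :=
  ⟨fun t => x (min t T), by simp, fun a b h => x.monotone (min_le_min_right _ h),
    fun t => (x.rightContinuous (min t T)).comp
      (f := fun u => min u T) (by fun_prop) fun _ hu => min_le_min_right T hu⟩

/-- The path which follows `x` up to time `T` and then has the increments of `y`. -/
def splice (T : ℝ≥0) (x y : CountingPath) : CountingPath :=
  ⟨fun t => x (min t T) + y (t - T), by simp,
    fun a b h => add_le_add (x.monotone (min_le_min_right _ h)) (y.monotone (by gcongr)),
    fun t => ContinuousWithinAt.add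
      ((x.rightContinuous (min t T)).comp
        (f := fun u => min u T) (by fun_prop) fun _ hu => min_le_min_right T hu)
      ((y.rightContinuous (t - T)).comp
        (f := fun u => u - T) (by fun_prop) fun _ hu => tsub_le_tsub_right hu T)⟩

lemma shift_apply (T : ℝ≥0) (x : CountingPath) (t : ℝ≥0) : shift T x t = x (T + t) - x T := rfl
lemma stopAt_apply (T : ℝ≥0) (x : CountingPath) (t : ℝ≥0) : stopAt T x t = x (min t T) := rfl
lemma splice_apply (T : ℝ≥0) (x y : CountingPath) (t : ℝ≥0) :
    splice T x y t = x (min t T) + y (t - T) := rfl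

lemma splice_apply_of_le {T : ℝ≥0} (x y : CountingPath) {t : ℝ≥0} (h : t ≤ T) :
    splice T x y t = x t := by
  simp [splice_apply, h, tsub_eq_zero_of_le h]

lemma splice_apply_add (T : ℝ≥0) (x y : CountingPath) (t : ℝ≥0) :
    splice T x y (T + t) = x T + y t := by
  simp [splice_apply]

lemma splice_shift_self (T : ℝ≥0) (x : CountingPath) : splice T x (shift T x) = x := by
  refine ext fun t => ?_
  rcases le_total t T with h | h
  · rw [splice_apply_of_le _ _ h]
  · obtain ⟨u, rfl⟩ := exists_add_of_le h
    rw [splice_apply_add, shift_apply, Nat.add_sub_cancel' (x.monotone h)]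

lemma shift_splice (T : ℝ≥0) (x y : CountingPath) : shift T (splice T x y) = y := by
  refine ext fun t => ?_
  rw [shift_apply, splice_apply_add, splice_apply_of_le _ _ le_rfl, Nat.add_sub_cancel_left]

/-- Only the stopped path matters, and for a Poisson path this is the part that is independent of
the later increments. -/
lemma splice_stopAt (T : ℝ≥0) (x y : CountingPath) : splice T (stopAt T x) y = splice T x y := by
  refine ext fun t => ?_
  simp [splice_apply, stopAt_apply]

lemma shift_shift (a b : ℝ≥0) (x : CountingPath) : shift a (shift b x) = shift (b + a) x := by
  refine ext fun t => ?_
  simp only [shift_apply, add_assoc]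
  have h1 := x.monotone (show b ≤ b + a by simp)
  have h2 := x.monotone (show b + a ≤ b + (a + t) by gcongr; simp)
  omega

lemma measurable_splice :
    Measurable fun p : ℝ≥0 × CountingPath × CountingPath => splice p.1 p.2.1 p.2.2 :=
  measurable_iff.2 fun _ =>
    (measurable_snd.fst.countingPath_eval (measurable_const.min measurable_fst)).add
      (measurable_snd.snd.countingPath_eval (measurable_const.sub measurable_fst))

lemma measurable_shift : Measurable fun p : ℝ≥0 × CountingPath => shift p.1 p.2 :=
  measurable_iff.2 fun _ =>
    (measurable_snd.countingPath_eval (measurable_fst.add_const _)).sub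
      (measurable_snd.countingPath_eval measurable_fst)

lemma measurable_stopAt (T : ℝ≥0) : Measurable (stopAt T) :=
  measurable_iff.2 fun _ => measurable_apply _

end CountingPath

/-! ### Poisson counters -/

/-- Reduces finite-dimensional distributions to independent increments: along such a sequence,
starting at 0, the values of a counter at the points of I are partial sums of increments. -/
lemma exists_monotone_enumeration (I : Finset ℝ≥0) :
    ∃ t : ℕ → ℝ≥0, Monotone t ∧ t 0 = 0 ∧ ∀ a ∈ I, ∃ i, t i = a := by
  classical
  let J := insert 0 I
  have hJ : 0 < J.card := Finset.card_pos.2 ⟨0, Finset.mem_insert_self _ _⟩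
  -- The sequence is made infinite by staying at the largest element of J.
  let t : ℕ → ℝ≥0 := fun i => J.orderEmbOfFin rfl ⟨min i (J.card - 1), by omega⟩
  have hmono : Monotone t := fun a b h => (J.orderEmbOfFin rfl).monotone
    (Fin.mk_le_mk.2 (min_le_min_right _ h))
  have hex : ∀ a ∈ J, ∃ i, t i = a := fun a ha => by
    obtain ⟨i, hi⟩ : a ∈ Set.range (J.orderEmbOfFin rfl) := by
      rw [Finset.range_orderEmbOfFin]; exact ha
    refine ⟨i, ?_⟩
    rw [← hi]
    refine congrArg (J.orderEmbOfFin rfl) (Fin.ext ?_)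
    have := i.2
    change min (i : ℕ) (J.card - 1) = i
    omega
  refine ⟨t, hmono, ?_, fun a ha => hex a (Finset.mem_insert_of_mem ha)⟩
  obtain ⟨i, hi⟩ := hex 0 (Finset.mem_insert_self _ _)
  exact le_antisymm (hi ▸ hmono (Nat.zero_le i)) zero_le

namespace IsPoissonCounter

variable {Ω : Type*} [MeasurableSpace Ω] {N : ℝ≥0 → Ω → ℕ} {r : ℝ≥0} {μ : Measure Ω}

/-- The path of a Poisson counter. -/
def path (hN : IsPoissonCounter N r μ) (ω : Ω) : CountingPath :=
  ⟨fun t => N t ω, hN.zero ω, hN.monotone ω, hN.rightContinuous ω⟩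

lemma measurable_path (hN : IsPoissonCounter N r μ) : Measurable hN.path :=
  CountingPath.measurable_iff.2 hN.measurable

lemma sum_increments (hN : IsPoissonCounter N r μ) {t : ℕ → ℝ≥0} (ht : Monotone t) (ω : Ω)
    {p q : ℕ} (hpq : p ≤ q) :
    ∑ i ∈ Finset.Ico p q, (N (t (i + 1)) ω - N (t i) ω) = N (t q) ω - N (t p) ω := by
  have hmono : Monotone fun i => N (t i) ω := fun a b h => hN.monotone ω (ht h)
  induction q, hpq using Nat.le_induction with
  | base => simp
  | succ q hq ih =>
    rw [Finset.sum_Ico_succ_top hq, ih]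
    have h1 := hmono hq
    have h2 := hmono (Nat.le_succ q)
    simp only [Nat.succ_eq_add_one] at h1 h2
    omega

lemma sum_range_increments (hN : IsPoissonCounter N r μ) {t : ℕ → ℝ≥0} (ht : Monotone t)
    (h0 : t 0 = 0) (ω : Ω) (q : ℕ) :
    ∑ i ∈ Finset.range q, (N (t (i + 1)) ω - N (t i) ω) = N (t q) ω := by
  rw [Finset.range_eq_Ico, hN.sum_increments ht ω (Nat.zero_le q), h0, hN.zero, Nat.sub_zero]

lemma hasLaw_increments (hN : IsPoissonCounter N r μ) {t : ℕ → ℝ≥0} (ht : Monotone t) :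
    HasLaw (fun ω (i : ℕ) => N (t (i + 1)) ω - N (t i) ω)
      (Measure.infinitePi fun i => poissonMeasure (r * (t (i + 1) - t i))) μ := by
  refine (hN.indepIncrements.nat ht).hasLaw_infinitePi
    (fun i => hN.law_increment _ _ (ht (Nat.le_succ i))) ?_
  exact (measurable_pi_lambda _ fun i =>
    (hN.measurable _).sub (hN.measurable _)).aemeasurable

/-- The law of a Poisson counter is determined by its rate. -/
lemma map_eq_map {Ω' : Type*} [MeasurableSpace Ω'] {N' : ℝ≥0 → Ω' → ℕ} {μ' : Measure Ω'}
    [IsProbabilityMeasure μ] [IsProbabilityMeasure μ']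
    (hN : IsPoissonCounter N r μ) (hN' : IsPoissonCounter N' r μ') :
    μ.map (fun ω t => N t ω) = μ'.map (fun ω t => N' t ω) := by
  have hm := measurable_pi_lambda _ hN.measurable
  have hm' := measurable_pi_lambda _ hN'.measurable
  have key : ∀ I : Finset ℝ≥0, μ.map (fun ω => I.restrict fun t => N t ω)
      = μ'.map (fun ω => I.restrict fun t => N' t ω) := fun I => by
    obtain ⟨t, ht, h0, hex⟩ := exists_monotone_enumeration I
    choose! ix hix using hex
    -- The values on I are the image under this one map g of the increments, whose joint law is the
    -- same product of Poisson laws for both counters.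
    let g : (ℕ → ℕ) → (I → ℕ) := fun D a => ∑ i ∈ Finset.range (ix a), D i
    have hg : Measurable g := by fun_prop
    have h1 : (fun ω => I.restrict fun t => N t ω)
        = g ∘ (fun ω (i : ℕ) => N (t (i + 1)) ω - N (t i) ω) := by
      ext ω a
      simp [g, hN.sum_range_increments ht h0, hix a a.2]
    have h2 : (fun ω => I.restrict fun t => N' t ω)
        = g ∘ (fun ω (i : ℕ) => N' (t (i + 1)) ω - N' (t i) ω) := by
      ext ω a
      simp [g, hN'.sum_range_increments ht h0, hix a a.2]
    rw [h1, h2, ← AEMeasurable.map_map_of_aemeasurable hg.aemeasurable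
      (hN.hasLaw_increments ht).aemeasurable, ← AEMeasurable.map_map_of_aemeasurable hg.aemeasurable
      (hN'.hasLaw_increments ht).aemeasurable, (hN.hasLaw_increments ht).map_eq,
      (hN'.hasLaw_increments ht).map_eq]
  have hl := isProjectiveLimit_map (X := N) (P := μ) hm.aemeasurable
  have hl' := isProjectiveLimit_map (X := N') (P := μ') hm'.aemeasurable
  simp_rw [key] at hl
  exact hl.unique hl'

lemma map_path_eq_map_path {Ω' : Type*} [MeasurableSpace Ω'] {N' : ℝ≥0 → Ω' → ℕ} {μ' : Measure Ω'}
    [IsProbabilityMeasure μ] [IsProbabilityMeasure μ']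
    (hN : IsPoissonCounter N r μ) (hN' : IsPoissonCounter N' r μ') :
    μ.map hN.path = μ'.map hN'.path := by
  refine CountingPath.measure_ext ?_
  rw [Measure.map_map CountingPath.measurable_coe hN.measurable_path,
    Measure.map_map CountingPath.measurable_coe hN'.measurable_path]
  exact hN.map_eq_map hN'

/-- The increments of a Poisson counter after a fixed time form a Poisson counter. -/
lemma shift (hN : IsPoissonCounter N r μ) (T : ℝ≥0) :
    IsPoissonCounter (fun t ω => N (T + t) ω - N T ω) r μ where
  measurable t := (hN.measurable _).sub (hN.measurable _)
  zero ω := by simp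
  monotone ω := (CountingPath.shift T (hN.path ω)).monotone
  rightContinuous ω := (CountingPath.shift T (hN.path ω)).rightContinuous
  indepIncrements n t ht := by
    have h := hN.indepIncrements n (fun i => T + t i) fun a b hab =>
      add_le_add_right (ht hab) T
    convert h using 3 with i ω
    have h1 := hN.monotone ω (show T ≤ T + t i.castSucc by simp)
    have h2 := hN.monotone ω (show T + t i.castSucc ≤ T + t i.succ by
      exact add_le_add_right (ht (Fin.castSucc_le_succ i)) T)
    beta_reduce at h1 h2 ⊢
    omega
  law_increment a b hab := by
    have h := hN.law_increment (T + a) (T + b) (by gcongr)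
    rw [add_tsub_add_eq_tsub_left] at h
    convert h using 2 with ω
    have h1 := hN.monotone ω (show T ≤ T + a by simp)
    have h2 := hN.monotone ω (show T + a ≤ T + b by gcongr)
    simp only at h1 h2
    omega

/-- A Poisson counter up to a fixed time is independent of its increments after that time. -/
lemma indepFun_stopAt_shift [IsProbabilityMeasure μ] (hN : IsPoissonCounter N r μ) (T : ℝ≥0) :
    IndepFun (fun ω t => N (min t T) ω) (fun ω t => N (T + t) ω - N T ω) μ := by
  classical
  refine IndepFun.process_indepFun_process (fun t => hN.measurable _)
    (fun t => (hN.measurable _).sub (hN.measurable _)) fun I J => ?_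
  -- A common refinement of all observation times that contains T itself, say at index p: the
  -- stopped values use the increments before p, the later ones those from p on.
  obtain ⟨t, ht, h0, hex⟩ := exists_monotone_enumeration
    (insert T (I.image (fun a => min a T) ∪ J.image (fun a => T + a)))
  obtain ⟨p, hp⟩ := hex T (by simp)
  have hexI : ∀ a ∈ I, ∃ i, i ≤ p ∧ t i = min a T := fun a ha => by
    obtain ⟨i, hi⟩ := hex (min a T) (by
      simp only [Finset.mem_insert, Finset.mem_union, Finset.mem_image]
      exact Or.inr (Or.inl ⟨a, ha, rfl⟩))
    rcases le_total i p with h | h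
    · exact ⟨i, h, hi⟩
    -- The enumeration may repeat values; an index beyond p with value at most T has value exactly T
    -- and can be replaced by p.
    · refine ⟨p, le_rfl, le_antisymm ?_ ?_⟩
      · rw [← hi]; exact ht h
      · rw [hp]; exact min_le_right _ _
  have hexJ : ∀ a ∈ J, ∃ i, p ≤ i ∧ t i = T + a := fun a ha => by
    obtain ⟨i, hi⟩ := hex (T + a) (by
      simp only [Finset.mem_insert, Finset.mem_union, Finset.mem_image]
      exact Or.inr (Or.inr ⟨a, ha, rfl⟩))
    rcases le_total p i with h | h
    · exact ⟨i, h, hi⟩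
    · refine ⟨p, le_rfl, le_antisymm ?_ ?_⟩
      · rw [hp]; simp
      · rw [← hi]; exact ht h
  choose! ix hixp hix using hexI
  choose! jx hjxp hjx using hexJ
  let n := J.sup jx
  have hind := (hN.indepIncrements.nat ht).indepFun_finset (Finset.range p) (Finset.Ico p n)
    (by rw [Finset.range_eq_Ico]; exact Finset.Ico_disjoint_Ico_consecutive 0 p n)
    fun i => (hN.measurable _).sub (hN.measurable _)
  let g : (Finset.range p → ℕ) → (I → ℕ) :=
    fun D a => ∑ i ∈ Finset.range (ix a), if h : i ∈ Finset.range p then D ⟨i, h⟩ else 0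
  let g' : (Finset.Ico p n → ℕ) → (J → ℕ) :=
    fun D a => ∑ i ∈ Finset.Ico p (jx a), if h : i ∈ Finset.Ico p n then D ⟨i, h⟩ else 0
  have hg : Measurable g := measurable_of_countable g
  have hg' : Measurable g' := measurable_of_countable g'
  convert hind.comp hg hg' using 1
  · ext ω a
    simp only [g, Function.comp]
    rw [← hix a a.2, ← hN.sum_range_increments ht h0]
    refine Finset.sum_congr rfl fun i hi => ?_
    rw [dif_pos]
    simp only [Finset.mem_range] at hi ⊢
    exact hi.trans_le (hixp a a.2)
  · ext ω a
    simp only [g', Function.comp]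
    have hle : jx a ≤ n := Finset.le_sup (f := jx) a.2
    rw [← hjx a a.2]
    conv_lhs => rw [← hp]
    rw [← hN.sum_increments ht ω (hjxp a a.2)]
    refine Finset.sum_congr rfl fun i hi => ?_
    rw [dif_pos]
    simp only [Finset.mem_Ico] at hi ⊢
    omega

end IsPoissonCounter

lemma CountingPath.indepFun_of_coe {Ω : Type*} [MeasurableSpace Ω] {μ : Measure Ω}
    {f g : Ω → CountingPath}
    (h : IndepFun (fun ω => (f ω : ℝ≥0 → ℕ)) (fun ω => (g ω : ℝ≥0 → ℕ)) μ) : IndepFun f g μ := by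
  rw [IndepFun_iff_Indep] at h ⊢
  have key : ∀ f : Ω → CountingPath, MeasurableSpace.comap f inferInstance
      = MeasurableSpace.comap (fun ω => (f ω : ℝ≥0 → ℕ)) inferInstance := fun f =>
    MeasurableSpace.comap_comp
  rwa [key f, key g]

/-- Splicing two independent Poisson paths at a fixed time gives a Poisson path. -/
lemma CountingPath.measurePreserving_splice {ν : Measure CountingPath} [IsProbabilityMeasure ν]
    {r : ℝ≥0} (hν : IsPoissonCounter (fun t (x : CountingPath) => x t) r ν) (T : ℝ≥0) :
    MeasurePreserving (fun p : CountingPath × CountingPath => splice T p.1 p.2) (ν.prod ν) ν := by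
  have hmeas : Measurable fun p : CountingPath × CountingPath => splice T p.1 p.2 :=
    measurable_splice.comp (measurable_const.prodMk measurable_id)
  have hsh : Measurable (shift T) := measurable_shift.comp (measurable_const.prodMk measurable_id)
  have hst := measurable_stopAt T
  refine ⟨hmeas, ?_⟩
  have hlaw : ν.map (shift T) = ν := by
    have h := (hν.shift T).map_path_eq_map_path hν
    have h1 : hν.path = id := rfl
    rw [h1, Measure.map_id] at h
    exact h
  have hind : IndepFun (stopAt T) (shift T) ν := indepFun_of_coe (hν.indepFun_stopAt_shift T)
  have hjoint := (indepFun_iff_map_prod_eq_prod_map_map hst.aemeasurable hsh.aemeasurable).1 hind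
  rw [hlaw] at hjoint
  -- By independence, stopping the first of two independent copies gives the same pair law as the
  -- stopped path and the shifted path of a single x, and splicing the latter pair returns x.
  have h1 : (ν.prod ν).map (Prod.map (stopAt T) id) = (ν.map (stopAt T)).prod ν := by
    rw [← Measure.map_prod_map _ _ hst measurable_id, Measure.map_id]
  have h2 : (fun p : CountingPath × CountingPath => splice T p.1 p.2) =
      (fun p : CountingPath × CountingPath => splice T p.1 p.2) ∘ Prod.map (stopAt T) id := by
    ext p
    simp [splice_stopAt]
  rw [h2, ← Measure.map_map hmeas (hst.prodMap measurable_id), h1, ← hjoint,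
    Measure.map_map hmeas (hst.prodMk hsh)]
  have h3 : ((fun p : CountingPath × CountingPath => splice T p.1 p.2) ∘
      fun x => (stopAt T x, shift T x)) = id := by
    ext x
    simp [splice_stopAt, splice_shift_self]
  rw [h3, Measure.map_id]

/-! ### Measure preserving rearrangements -/

lemma MeasureTheory.measurePreserving_prodProdProdComm {α β γ δ : Type*} [MeasurableSpace α]
    [MeasurableSpace β] [MeasurableSpace γ] [MeasurableSpace δ] (μa : Measure α) (μb : Measure β)
    (μc : Measure γ) (μd : Measure δ) [SFinite μa] [SFinite μb] [SFinite μc] [SFinite μd] :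
    MeasurePreserving (fun p : (α × β) × (γ × δ) => ((p.1.1, p.2.1), (p.1.2, p.2.2)))
      ((μa.prod μb).prod (μc.prod μd)) ((μa.prod μc).prod (μb.prod μd)) := by
  have h1 := measurePreserving_prodAssoc μa μb (μc.prod μd)
  have h2 := (MeasurePreserving.id μa).prod (measurePreserving_prodAssoc μb μc μd).symm
  have h3 := (MeasurePreserving.id μa).prod
    ((Measure.measurePreserving_swap (μ := μb) (ν := μc)).prod (MeasurePreserving.id μd))
  have h4 := (MeasurePreserving.id μa).prod (measurePreserving_prodAssoc μc μb μd)
  have h5 := (measurePreserving_prodAssoc μa μc (μb.prod μd)).symm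
  exact h5.comp (h4.comp (h3.comp (h2.comp h1)))

/-- The sequence whose first `d` terms are those of `a`, followed by `b`. -/
def seqJoin {α : Type*} (d : ℕ) (a b : ℕ → α) (i : ℕ) : α := if i < d then a i else b (i - d)

lemma seqJoin_of_lt {α : Type*} {d : ℕ} (a b : ℕ → α) {i : ℕ} (h : i < d) :
    seqJoin d a b i = a i := if_pos h

@[simp] lemma seqJoin_add {α : Type*} (d : ℕ) (a b : ℕ → α) (i : ℕ) :
    seqJoin d a b (d + i) = b i := by
  simp [seqJoin]

lemma measurable_seqJoin {α : Type*} [MeasurableSpace α] (d : ℕ) :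
    Measurable fun p : (ℕ → α) × (ℕ → α) => seqJoin d p.1 p.2 := by
  refine measurable_pi_lambda _ fun i => ?_
  by_cases h : i < d
  · simp only [seqJoin, if_pos h]
    exact (measurable_pi_apply i).comp measurable_fst
  · simp only [seqJoin, if_neg h]
    exact (measurable_pi_apply (i - d)).comp measurable_snd

/-- The preimage of a cylinder is a product of two cylinders, one over its coordinates below d and
one over the others moved down by d, so the product of the factors merely splits in two. -/
lemma measurePreserving_seqJoin {α : Type*} [MeasurableSpace α] (ρ : Measure α)
    [IsProbabilityMeasure ρ] (d : ℕ) :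
    MeasurePreserving (fun p : (ℕ → α) × (ℕ → α) => seqJoin d p.1 p.2)
      ((Measure.infinitePi fun _ => ρ).prod (Measure.infinitePi fun _ => ρ))
      (Measure.infinitePi fun _ => ρ) := by
  classical
  refine ⟨measurable_seqJoin d, Measure.eq_infinitePi _ fun s t ht => ?_⟩
  rw [Measure.map_apply (measurable_seqJoin d) (.pi s.countable_toSet fun _ _ => ht _)]
  have hpre : (fun p : (ℕ → α) × (ℕ → α) => seqJoin d p.1 p.2) ⁻¹' (s : Set ℕ).pi t
      = ((s.filter (· < d) : Finset ℕ) : Set ℕ).pi t ×ˢ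
        (((s.filter (¬ · < d)).image (· - d) : Finset ℕ) : Set ℕ).pi (fun i => t (d + i)) := by
    ext p
    simp only [Set.mem_preimage, Set.mem_pi, Set.mem_prod, Finset.mem_coe, Finset.mem_filter,
      Finset.mem_image, seqJoin]
    constructor
    · refine fun h => ⟨fun i hi => by simpa [hi.2] using h i hi.1, ?_⟩
      rintro _ ⟨i, hi, rfl⟩
      have := h i hi.1
      rwa [if_neg hi.2, show t i = t (d + (i - d)) by congr 1; omega] at this
    · rintro ⟨h1, h2⟩ i hi
      split_ifs with hd
      · exact h1 i ⟨hi, hd⟩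
      · have := h2 (i - d) ⟨i, ⟨hi, hd⟩, rfl⟩
        rwa [show d + (i - d) = i by omega] at this
  rw [hpre, Measure.prod_prod, Measure.infinitePi_pi _ fun i _ => ht i,
    Measure.infinitePi_pi _ fun i _ => ht (d + i), Finset.prod_image,
    ← Finset.prod_filter_mul_prod_filter_not s (· < d)]
  · congr 1
    refine Finset.prod_congr rfl fun i hi => ?_
    have := (Finset.mem_filter.1 hi).2
    rw [show d + (i - d) = i by omega]
  · intro a ha b hb hab
    have h1 := (Finset.mem_filter.1 ha).2
    have h2 := (Finset.mem_filter.1 hb).2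
    simp only at hab
    omega

/-! ### The randomness of the network -/

/-- The inputs of the network: the cycle lengths, the sets of nodes which receive a key of a given
version directly from the source, and the activations of the edges. -/
abbrev NetworkData (m : ℕ) : Type :=
  (ℕ → ℝ≥0) × (ℕ → Finset (Fin m)) × (GossipEdge m → CountingPath)

namespace NetworkData

variable {m : ℕ}

/-- The time of the `l`-th update. -/
def time (x : NetworkData m) (l : ℕ) : ℝ≥0 := ∑ i ∈ Finset.range l, x.1 i

/-- The network after the first `d` version cycles. -/
def shift (d : ℕ) (x : NetworkData m) : NetworkData m :=
  (fun i => x.1 (d + i), fun i => x.2.1 (d + i), fun e => (x.2.2 e).shift (x.time d))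

/-- The network which follows `x` for `d` version cycles and then continues as `y`. -/
def join (d : ℕ) (x y : NetworkData m) : NetworkData m :=
  (seqJoin d x.1 y.1, seqJoin d x.2.1 y.2.1, fun e => (x.2.2 e).splice (x.time d) (y.2.2 e))

@[simp] lemma time_zero (x : NetworkData m) : x.time 0 = 0 := rfl

lemma monotone_time (x : NetworkData m) : Monotone x.time := fun _ _ h =>
  Finset.sum_le_sum_of_subset (Finset.range_mono h)

lemma time_shift (d : ℕ) (x : NetworkData m) (l : ℕ) :
    x.time d + (shift d x).time l = x.time (d + l) := by
  simp [time, shift, Finset.sum_range_add]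

lemma shift_shift (a b : ℕ) (x : NetworkData m) : shift a (shift b x) = shift (b + a) x := by
  refine Prod.ext ?_ (Prod.ext ?_ ?_)
  · ext i; simp [shift, add_assoc]
  · funext i; simp [shift, add_assoc]
  · funext e
    change CountingPath.shift _ (CountingPath.shift _ _) = CountingPath.shift _ _
    rw [CountingPath.shift_shift, time_shift]

lemma time_join_of_le {d : ℕ} (x y : NetworkData m) {l : ℕ} (h : l ≤ d) :
    (join d x y).time l = x.time l :=
  Finset.sum_congr rfl fun _ hi => seqJoin_of_lt _ _ ((Finset.mem_range.1 hi).trans_le h)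

lemma shift_join (d : ℕ) (x y : NetworkData m) : shift d (join d x y) = y := by
  refine Prod.ext ?_ (Prod.ext ?_ ?_)
  · ext i; simp [shift, join]
  · funext i; simp [shift, join]
  · funext e
    change CountingPath.shift _ (CountingPath.splice _ _ _) = _
    rw [time_join_of_le _ _ le_rfl, CountingPath.shift_splice]

lemma time_join_add (d : ℕ) (x y : NetworkData m) (l : ℕ) :
    (join d x y).time (d + l) = x.time d + y.time l := by
  rw [← time_shift, shift_join, time_join_of_le _ _ le_rfl]

lemma measurable_time (l : ℕ) : Measurable fun x : NetworkData m => x.time l :=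
  Finset.measurable_fun_sum _ fun i _ => (measurable_pi_apply i).comp measurable_fst

lemma measurable_path (e : GossipEdge m) : Measurable fun x : NetworkData m => x.2.2 e :=
  (measurable_pi_apply e).comp measurable_snd.snd

lemma measurable_holders (l : ℕ) : Measurable fun x : NetworkData m => x.2.1 l :=
  (measurable_pi_apply l).comp measurable_snd.fst

lemma measurable_shift (d : ℕ) : Measurable (shift d : NetworkData m → NetworkData m) := by
  refine (measurable_pi_lambda _ fun i => (measurable_pi_apply (d + i)).comp measurable_fst).prodMk
    ((measurable_pi_lambda _ fun i => measurable_holders (d + i)).prodMk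
      (measurable_pi_lambda _ fun e => ?_))
  exact CountingPath.measurable_shift.comp ((measurable_time d).prodMk (measurable_path e))

/-- The law of the inputs of the network, with independent cycle lengths, key holders and
activations. -/
noncomputable def law (ρ : Measure ℝ≥0) (κ : Measure (Finset (Fin m)))
    (ν : Measure CountingPath) : Measure (NetworkData m) :=
  (Measure.infinitePi fun _ => ρ).prod
    ((Measure.infinitePi fun _ => κ).prod (Measure.pi fun _ => ν))

variable {ρ : Measure ℝ≥0} {κ : Measure (Finset (Fin m))} {ν : Measure CountingPath}
  [IsProbabilityMeasure ρ] [IsProbabilityMeasure κ] [IsProbabilityMeasure ν]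

instance : IsProbabilityMeasure (law ρ κ ν) := by
  unfold law; infer_instance

lemma measurePreserving_splice {r : ℝ≥0}
    (hν : IsPoissonCounter (fun t (x : CountingPath) => x t) r ν) (T : ℝ≥0) :
    MeasurePreserving
      (fun p : (GossipEdge m → CountingPath) × (GossipEdge m → CountingPath) =>
        fun e => (p.1 e).splice T (p.2 e))
      ((Measure.pi fun _ => ν).prod (Measure.pi fun _ => ν)) (Measure.pi fun _ => ν) := by
  have h1 := (measurePreserving_arrowProdEquivProdArrow CountingPath CountingPath (GossipEdge m)
    (fun _ => ν) (fun _ => ν)).symm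
  have h2 := measurePreserving_pi (fun _ : GossipEdge m => ν.prod ν) (fun _ => ν)
    fun _ => CountingPath.measurePreserving_splice hν T
  exact h2.comp h1

/-- After `d` version cycles, the network starts afresh, independently of the past. -/
theorem measurePreserving_join {r : ℝ≥0}
    (hν : IsPoissonCounter (fun t (x : CountingPath) => x t) r ν) (d : ℕ) :
    MeasurePreserving (fun p : NetworkData m × NetworkData m => join d p.1 p.2)
      ((law ρ κ ν).prod (law ρ κ ν)) (law ρ κ ν) := by
  let τ : (ℕ → ℝ≥0) → ℝ≥0 := fun c => ∑ i ∈ Finset.range d, c i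
  have hτ : Measurable τ := Finset.measurable_fun_sum _ fun i _ => measurable_pi_apply i
  -- The splicing time is random, but a function of the cycle lengths alone. Once these are fixed,
  -- splicing at a constant time applies, so the join is a skew product over the cycle lengths.
  let g : (ℕ → ℝ≥0) × (ℕ → ℝ≥0) →
      ((ℕ → Finset (Fin m)) × (GossipEdge m → CountingPath)) ×
        ((ℕ → Finset (Fin m)) × (GossipEdge m → CountingPath)) →
      (ℕ → Finset (Fin m)) × (GossipEdge m → CountingPath) :=
    fun c q => (seqJoin d q.1.1 q.2.1, fun e => (q.1.2 e).splice (τ c.1) (q.2.2 e))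
  have hg : Measurable (Function.uncurry g) := by
    refine ((measurable_seqJoin d).comp
      (measurable_snd.fst.fst.prodMk measurable_snd.snd.fst)).prodMk
      (measurable_pi_lambda _ fun e => ?_)
    have he : Measurable fun N : GossipEdge m → CountingPath => N e := measurable_pi_apply e
    exact CountingPath.measurable_splice.comp ((hτ.comp measurable_fst.fst).prodMk
      ((he.comp measurable_snd.fst.snd).prodMk (he.comp measurable_snd.snd.snd)))
  have hg' : ∀ c, Measure.map (g c)
      (((Measure.infinitePi fun _ => κ).prod (Measure.pi fun _ => ν)).prod
        ((Measure.infinitePi fun _ => κ).prod (Measure.pi fun _ => ν)))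
      = (Measure.infinitePi fun _ => κ).prod (Measure.pi fun _ => ν) := fun c =>
    (((measurePreserving_seqJoin κ d).prod (measurePreserving_splice hν (τ c.1))).comp
      (measurePreserving_prodProdProdComm _ _ _ _)).map_eq
  have h := ((measurePreserving_seqJoin ρ d).skew_product hg (ae_of_all _ hg')).comp
    (measurePreserving_prodProdProdComm (Measure.infinitePi fun _ => ρ)
      ((Measure.infinitePi fun _ => κ).prod (Measure.pi fun _ : GossipEdge m => ν))
      (Measure.infinitePi fun _ => ρ)
      ((Measure.infinitePi fun _ => κ).prod (Measure.pi fun _ : GossipEdge m => ν)))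
  exact h

/-- Shifting a join returns its second argument, which has law `law`, while the join itself also has
law `law`. -/
lemma measurePreserving_shift {r : ℝ≥0}
    (hν : IsPoissonCounter (fun t (x : CountingPath) => x t) r ν) (d : ℕ) :
    MeasurePreserving (shift d) (law ρ κ ν) (law ρ κ ν) := by
  refine ⟨measurable_shift d, ?_⟩
  have h := measurePreserving_join (m := m) (ρ := ρ) (κ := κ) hν d
  conv_lhs => rw [← h.map_eq]
  rw [Measure.map_map (measurable_shift d) h.measurable]
  have h1 : (shift d ∘ fun p : NetworkData m × NetworkData m => join d p.1 p.2) = Prod.snd := by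
    ext1 p
    exact shift_join d p.1 p.2
  rw [h1, measurePreserving_snd.map_eq]

end NetworkData

namespace NetworkData

variable {m : ℕ}

/-! ### Decryption delays -/

open Classical in
/-- The nodes whose key of version `l` is held by node `j` at a time `u` after the update. -/
noncomputable def heldKeys (j : Fin m) (x : NetworkData m) (l : ℕ) (u : ℝ≥0) : Finset (Fin m) :=
  (x.2.1 l).filter fun i => i = j ∨ ∃ h : i ≠ j, x.2.2 ⟨(i, j), h⟩ (x.time l) < x.2.2 ⟨(i, j), h⟩ u

lemma mem_heldKeys {j : Fin m} {x : NetworkData m} {l : ℕ} {u : ℝ≥0} {i : Fin m} :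
    i ∈ heldKeys j x l u ↔ i ∈ x.2.1 l ∧
      (i = j ∨ ∃ h : i ≠ j, x.2.2 ⟨(i, j), h⟩ (x.time l) < x.2.2 ⟨(i, j), h⟩ u) := by
  classical
  simp [heldKeys]

/-- At time `u`, node `j` has at most `k` keys of each version. -/
def Undecrypted (k : ℕ) (j : Fin m) (x : NetworkData m) (u : ℝ≥0) : Prop :=
  ∀ l, x.time l ≤ u → (heldKeys j x l u).card ≤ k

lemma measurableSet_undecrypted (k : ℕ) (j : Fin m) :
    MeasurableSet {p : NetworkData m × ℝ | Undecrypted k j p.1 p.2.toNNReal} := by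
  have hu : Measurable fun p : NetworkData m × ℝ => p.2.toNNReal :=
    measurable_real_toNNReal.comp measurable_snd
  have ht : ∀ l, Measurable fun p : NetworkData m × ℝ => p.1.time l := fun l =>
    (measurable_time l).comp measurable_fst
  have hK : ∀ l, Measurable fun p : NetworkData m × ℝ => heldKeys j p.1 l p.2.toNNReal := by
    intro l
    rw [measurable_finset_iff]
    intro a
    have h1 : MeasurableSet {p : NetworkData m × ℝ | a ∈ p.1.2.1 l} :=
      (measurable_holders l).comp measurable_fst (measurableSet_mem_finset a)
    refine measurableSet_setOfPred.1 ?_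
    by_cases haj : a = j
    · simp only [mem_heldKeys, haj, true_or, and_true]
      exact haj ▸ h1
    · have hp : Measurable fun p : NetworkData m × ℝ => p.1.2.2 ⟨(a, j), haj⟩ :=
        (measurable_path _).comp measurable_fst
      have h2 := measurableSet_lt (hp.countingPath_eval (ht l)) (hp.countingPath_eval hu)
      convert h1.inter h2 using 1
      ext p
      simp [mem_heldKeys, haj]
  have : {p : NetworkData m × ℝ | Undecrypted k j p.1 p.2.toNNReal} = ⋂ l,
      ({p | p.1.time l ≤ p.2.toNNReal}ᶜ ∪ {p | (heldKeys j p.1 l p.2.toNNReal).card ≤ k}) := by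
    ext p
    simp only [Undecrypted, Set.mem_ofPred_eq, Set.mem_iInter, Set.mem_union, Set.mem_compl_iff,
      imp_iff_not_or]
  rw [this]
  refine MeasurableSet.iInter fun l => (measurableSet_le (ht l) hu).compl.union ?_
  exact measurableSet_le ((measurable_of_countable Finset.card).comp (hK l)) measurable_const

/-- The time during which `j` has at most `k` keys of each version. -/
noncomputable def delay (k : ℕ) (j : Fin m) (x : NetworkData m) : ℝ≥0∞ :=
  volume.restrict (Set.Ici (0 : ℝ)) {u | Undecrypted k j x u.toNNReal}

/-- The time before the `d`-th update during which `j` has at most `k` keys of each version. -/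
noncomputable def delayBefore (k : ℕ) (j : Fin m) (d : ℕ) (x : NetworkData m) : ℝ≥0∞ :=
  volume.restrict (Set.Ici (0 : ℝ)) {u | u < x.time d ∧ Undecrypted k j x u.toNNReal}

/-- The time of the first activation of the edge `e`. -/
noncomputable def firstActivation (e : GossipEdge m) (x : NetworkData m) : ℝ≥0∞ :=
  volume.restrict (Set.Ici (0 : ℝ)) {u | x.2.2 e u.toNNReal = 0}

lemma measurable_delay (k : ℕ) (j : Fin m) : Measurable (delay k j) :=
  measurable_measure_prodMk_left (measurableSet_undecrypted k j)

lemma measurableSet_undecrypted_before (k : ℕ) (j : Fin m) (d : ℕ) :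
    MeasurableSet {p : NetworkData m × ℝ |
      p.2 < p.1.time d ∧ Undecrypted k j p.1 p.2.toNNReal} :=
  (measurableSet_lt measurable_snd
    ((measurable_time d).comp measurable_fst).coe_nnreal_real).inter (measurableSet_undecrypted k j)

lemma measurable_delayBefore (k : ℕ) (j : Fin m) (d : ℕ) : Measurable (delayBefore k j d) :=
  measurable_measure_prodMk_left (measurableSet_undecrypted_before k j d)

lemma measurableSet_noActivation (e : GossipEdge m) :
    MeasurableSet {p : NetworkData m × ℝ | p.1.2.2 e p.2.toNNReal = 0} :=
  (((measurable_path e).comp measurable_fst).countingPath_eval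
    (measurable_real_toNNReal.comp measurable_snd)) (measurableSet_singleton 0)

lemma measurable_firstActivation (e : GossipEdge m) : Measurable (firstActivation e) :=
  measurable_measure_prodMk_left (measurableSet_noActivation e)

lemma delayBefore_le_delay (k : ℕ) (j : Fin m) (d : ℕ) (x : NetworkData m) :
    delayBefore k j d x ≤ delay k j x :=
  measure_mono fun _ hu => hu.2

/-- Before the d-th update only versions below d have been sent, and the spliced paths still agree
with those of x. -/
lemma undecrypted_join {k : ℕ} {j : Fin m} {d : ℕ} {x y : NetworkData m} {u : ℝ≥0}
    (hu : u < x.time d) : Undecrypted k j (join d x y) u ↔ Undecrypted k j x u := by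
  have key : ∀ l, l < d → x.time l ≤ u → heldKeys j (join d x y) l u = heldKeys j x l u := by
    intro l hl hlu
    ext i
    have h1 : (join d x y).2.1 l = x.2.1 l := seqJoin_of_lt _ _ hl
    have h2 : ∀ e t, t ≤ x.time d → (join d x y).2.2 e t = x.2.2 e t := fun e t ht =>
      CountingPath.splice_apply_of_le _ _ ht
    simp only [mem_heldKeys, h1, time_join_of_le x y hl.le, h2 _ _ hu.le,
      h2 _ _ (hlu.trans hu.le)]
  constructor
  · intro h l hl
    have hld : l < d := by
      by_contra hcon
      exact absurd (x.monotone_time (not_lt.1 hcon)) (not_le.2 (hl.trans_lt hu))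
    rw [← key l hld hl]
    exact h l (by rwa [time_join_of_le x y hld.le])
  · intro h l hl
    have hld : l < d := by
      by_contra hcon
      have := (join d x y).monotone_time (not_lt.1 hcon)
      rw [time_join_of_le x y le_rfl] at this
      exact absurd this (not_le.2 (hl.trans_lt hu))
    rw [time_join_of_le x y hld.le] at hl
    rw [key l hld hl]
    exact h l hl

/-- Shows that the truncated delay depends on the first d cycles only, as the factorisation
`lintegral_mul_shift` requires. -/
lemma delayBefore_join (k : ℕ) (j : Fin m) (d : ℕ) (x y : NetworkData m) :
    delayBefore k j d (join d x y) = delayBefore k j d x := by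
  unfold delayBefore
  rw [time_join_of_le x y le_rfl]
  refine measure_congr ?_
  filter_upwards [ae_restrict_mem measurableSet_Ici] with u hu
  refine propext (and_congr_right fun h => undecrypted_join ?_)
  rw [Real.toNNReal_lt_iff_lt_coe hu]
  exact h

/-- Version 0 is sent at time 0. Had every edge been activated by time u, node j would hold all its
keys, which are more than k. -/
lemma exists_path_eq_zero {k : ℕ} {j : Fin m} {x : NetworkData m} {u : ℝ≥0}
    (hx : k < (x.2.1 0).card) (h : Undecrypted k j x u) : ∃ e, x.2.2 e u = 0 := by
  by_contra! hcon
  refine absurd (h 0 zero_le) (not_le.2 (hx.trans_le (Finset.card_le_card fun i hi => ?_)))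
  rw [mem_heldKeys]
  refine ⟨hi, or_iff_not_imp_left.2 fun hij => ⟨hij, ?_⟩⟩
  rw [time_zero, CountingPath.map_zero]
  exact Nat.pos_of_ne_zero (hcon _)

/-- A decryption delay which exceeds `d` cycles is due to an edge which is not activated during
these cycles. -/
lemma delay_le_delayBefore_add {k : ℕ} (j : Fin m) {x : NetworkData m}
    (hx : k < (x.2.1 0).card) (d : ℕ) :
    delay k j x ≤ delayBefore k j d x + ∑ e, ({x | x.2.2 e (x.time d) = 0} :
      Set (NetworkData m)).indicator 1 x * firstActivation e (shift d x) := by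
  classical
  have hsub : {u : ℝ | Undecrypted k j x u.toNNReal} ⊆
      {u : ℝ | u < x.time d ∧ Undecrypted k j x u.toNNReal} ∪
        ⋃ e, {u : ℝ | x.time d ≤ u ∧ x.2.2 e u.toNNReal = 0} := fun u hu => by
    rcases lt_or_ge u (x.time d) with h | h
    · exact Or.inl ⟨h, hu⟩
    · obtain ⟨e, he⟩ := exists_path_eq_zero hx hu
      exact Or.inr (Set.mem_iUnion.2 ⟨e, h, he⟩)
  refine (measure_mono hsub).trans ((measure_union_le _ _).trans (add_le_add_right ?_ _))
  refine (measure_iUnion_le _).trans ?_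
  rw [tsum_fintype]
  refine Finset.sum_le_sum fun e _ => ?_
  by_cases h0 : x.2.2 e (x.time d) = 0
  · rw [Set.indicator_of_mem (by exact h0), Pi.one_apply, one_mul]
    unfold firstActivation
    have hms : MeasurableSet {u : ℝ | (shift d x).2.2 e u.toNNReal = 0} :=
      measurable_prodMk_left (measurableSet_noActivation e)
    rw [Measure.restrict_apply hms]
    refine (Measure.restrict_apply_le _ _).trans ?_
    -- Lebesgue measure is translation invariant, so time can be counted from the d-th update; as e
    -- is silent until then, the shifted path also vanishes.
    rw [← measure_preimage_add_right volume (-(x.time d : ℝ)) (_ ∩ Set.Ici 0)]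
    refine measure_mono fun u hu => ?_
    rw [Set.mem_preimage, ← sub_eq_add_neg]
    refine ⟨?_, sub_nonneg.2 hu.1⟩
    have h1 : x.time d + (u - x.time d).toNNReal = u.toNNReal := by
      rw [← NNReal.coe_inj, NNReal.coe_add, Real.coe_toNNReal _ (sub_nonneg.2 hu.1),
        Real.coe_toNNReal _ ((x.time d).2.trans hu.1)]
      ring
    change (x.2.2 e) (x.time d + (u - x.time d).toNNReal) - x.2.2 e (x.time d) = 0
    rw [h1, hu.2, Nat.zero_sub]
  · rw [Set.indicator_of_notMem (by exact h0), zero_mul, nonpos_iff_eq_zero]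
    convert measure_empty (μ := volume.restrict (Set.Ici (0 : ℝ)))
    ext u
    simp only [Set.mem_ofPred_eq, Set.mem_empty_iff_false, iff_false, not_and]
    intro hu h
    have : x.2.2 e (x.time d) ≤ x.2.2 e u.toNNReal :=
      (x.2.2 e).monotone (NNReal.le_toNNReal_of_coe_le hu)
    omega

lemma delay_le_sum_firstActivation {k : ℕ} (j : Fin m) {x : NetworkData m}
    (hx : k < (x.2.1 0).card) : delay k j x ≤ ∑ e, firstActivation e x := by
  have hsub : {u : ℝ | Undecrypted k j x u.toNNReal} ⊆ ⋃ e, {u : ℝ | x.2.2 e u.toNNReal = 0} :=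
    fun u hu => Set.mem_iUnion.2 (exists_path_eq_zero hx hu)
  refine (measure_mono hsub).trans ((measure_iUnion_le _).trans ?_)
  rw [tsum_fintype]
  rfl

end NetworkData

/-! ### Moments and correlations of the delays -/

lemma IsPoissonCounter.measure_eq_zero {Ω : Type*} [MeasurableSpace Ω] {N : ℝ≥0 → Ω → ℕ} {r : ℝ≥0}
    {μ : Measure Ω} (hN : IsPoissonCounter N r μ) (u : ℝ≥0) :
    μ {ω | N u ω = 0} = ENNReal.ofReal (Real.exp (-(r * u))) := by
  have h := (hN.law_increment 0 u zero_le).measure_eq (p := fun n => n = 0)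
    (measurableSet_singleton 0)
  simp only [hN.zero, tsub_zero] at h
  rw [h, show {x : ℕ | x = 0} = {0} from rfl, poissonMeasure_singleton]
  simp

namespace NetworkData

variable {m : ℕ} {ρ : Measure ℝ≥0} {κ : Measure (Finset (Fin m))} {ν : Measure CountingPath}
  [IsProbabilityMeasure ρ] [IsProbabilityMeasure κ] [IsProbabilityMeasure ν]

lemma measurePreserving_path (e : GossipEdge m) :
    MeasurePreserving (fun x : NetworkData m => x.2.2 e) (law ρ κ ν) ν :=
  (measurePreserving_eval (fun _ => ν) e).comp (measurePreserving_snd.comp measurePreserving_snd)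

lemma measurePreserving_holders (l : ℕ) :
    MeasurePreserving (fun x : NetworkData m => x.2.1 l) (law ρ κ ν) κ :=
  (measurePreserving_eval_infinitePi (fun _ => κ) l).comp
    (measurePreserving_fst.comp measurePreserving_snd)

lemma measurePreserving_cycle_path (e : GossipEdge m) :
    MeasurePreserving (fun x : NetworkData m => (x.1 0, x.2.2 e)) (law ρ κ ν) (ρ.prod ν) :=
  (measurePreserving_eval_infinitePi (fun _ => ρ) 0).prod
    ((measurePreserving_eval (fun _ => ν) e).comp measurePreserving_snd)

variable {r : ℝ≥0}

lemma law_path_eq_zero (hν : IsPoissonCounter (fun t (x : CountingPath) => x t) r ν)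
    (e : GossipEdge m) (u : ℝ≥0) :
    law ρ κ ν {x | x.2.2 e u = 0} = ENNReal.ofReal (Real.exp (-(r * u))) := by
  rw [← hν.measure_eq_zero u]
  exact (measurePreserving_path (ρ := ρ) (κ := κ) (ν := ν) e).measure_preimage
    ((CountingPath.measurable_apply u) (measurableSet_singleton 0)).nullMeasurableSet

lemma law_path_toNNReal_eq_zero_le (hν : IsPoissonCounter (fun t (x : CountingPath) => x t) r ν)
    (e : GossipEdge m) (u : ℝ) :
    law ρ κ ν {x | x.2.2 e u.toNNReal = 0} ≤ ENNReal.ofReal (Real.exp (-r * u)) := by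
  rw [law_path_eq_zero hν]
  refine ENNReal.ofReal_le_ofReal (Real.exp_le_exp.2 ?_)
  have := mul_le_mul_of_nonneg_left (Real.le_coe_toNNReal u) r.coe_nonneg
  linarith

lemma lintegral_exp_ne_top {b : ℝ} (hb : 0 < b) :
    ∫⁻ u in Set.Ici (0 : ℝ), ENNReal.ofReal (Real.exp (-b * u)) ≠ ⊤ :=
  (((integrableOn_Ici_iff_integrableOn_Ioi (by simp)).2 (exp_neg_integrableOn_Ioi 0 hb)).lintegral_lt_top).ne

/-- By Tonelli, the mean is the integral over u of the probability of no activation by time u, which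
is dominated by exp (-r u). -/
lemma lintegral_firstActivation_ne_top (hr : 0 < r)
    (hν : IsPoissonCounter (fun t (x : CountingPath) => x t) r ν) (e : GossipEdge m) :
    ∫⁻ x, firstActivation e x ∂(law ρ κ ν) ≠ ⊤ := by
  refine ne_top_of_le_ne_top (lintegral_exp_ne_top (b := r) hr) ?_
  have h := Measure.prod_apply (μ := law ρ κ ν) (ν := volume.restrict (Set.Ici (0 : ℝ)))
    (measurableSet_noActivation e)
  rw [Measure.prod_apply_symm (measurableSet_noActivation e)] at h
  refine h.symm.le.trans (lintegral_mono fun u => ?_)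
  exact law_path_toNNReal_eq_zero_le hν e u

/-- The product is the area of a planar set, so Tonelli applies again. The probability at (u, v) is
at most exp (-r max(u, v)), hence at most exp (-r u / 2) exp (-r v / 2), which needs no independence
and covers e = e'. -/
lemma lintegral_firstActivation_mul_ne_top (hr : 0 < r)
    (hν : IsPoissonCounter (fun t (x : CountingPath) => x t) r ν) (e e' : GossipEdge m) :
    ∫⁻ x, firstActivation e x * firstActivation e' x ∂(law ρ κ ν) ≠ ⊤ := by
  let lam := volume.restrict (Set.Ici (0 : ℝ))
  let B : ℝ → ℝ≥0∞ := fun u => ENNReal.ofReal (Real.exp (-(r / 2 : ℝ) * u))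
  have hB : Measurable B := by fun_prop
  have hfin : ∫⁻ u, B u ∂lam ≠ ⊤ := lintegral_exp_ne_top (by positivity)
  refine ne_top_of_le_ne_top (ENNReal.mul_ne_top hfin hfin) ?_
  let A : Set (NetworkData m × ℝ × ℝ) :=
    {p | p.1.2.2 e p.2.1.toNNReal = 0} ∩ {p | p.1.2.2 e' p.2.2.toNNReal = 0}
  have hA : MeasurableSet A :=
    ((measurable_fst.prodMk measurable_snd.fst) (measurableSet_noActivation e)).inter
      ((measurable_fst.prodMk measurable_snd.snd) (measurableSet_noActivation e'))
  have h := Measure.prod_apply (μ := law ρ κ ν) (ν := lam.prod lam) hA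
  rw [Measure.prod_apply_symm hA] at h
  have h1 : ∀ x, firstActivation e x * firstActivation e' x
      = (lam.prod lam) (Prod.mk x ⁻¹' A) := fun x => (Measure.prod_prod _ _).symm
  simp_rw [h1]
  rw [← h, ← lintegral_prod_mul hB.aemeasurable hB.aemeasurable]
  refine lintegral_mono fun q => ?_
  have hexp : ∀ w : ℝ, (q.1 + q.2) / 2 ≤ w →
      ENNReal.ofReal (Real.exp (-r * w)) ≤ B q.1 * B q.2 := fun w hw => by
    rw [← ENNReal.ofReal_mul (Real.exp_nonneg _), ← Real.exp_add]
    refine ENNReal.ofReal_le_ofReal (Real.exp_le_exp.2 ?_)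
    have := mul_le_mul_of_nonneg_left hw r.coe_nonneg
    linarith
  rcases le_total q.1 q.2 with hq | hq
  · exact ((measure_mono fun x hx => hx.2).trans (law_path_toNNReal_eq_zero_le hν e' q.2)).trans
      (hexp _ (by linarith))
  · exact ((measure_mono fun x hx => hx.1).trans (law_path_toNNReal_eq_zero_le hν e q.1)).trans
      (hexp _ (by linarith))

lemma measurableSet_path_time_eq_zero (e : GossipEdge m) (d : ℕ) :
    MeasurableSet {x : NetworkData m | x.2.2 e (x.time d) = 0} :=
  ((measurable_path e).countingPath_eval (measurable_time d)) (measurableSet_singleton 0)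

/-- Restarting after one cycle: silence over 1 + d cycles is silence in the first cycle and,
independently, over d cycles of the restarted network. -/
lemma law_path_time_eq_zero (hν : IsPoissonCounter (fun t (x : CountingPath) => x t) r ν)
    (e : GossipEdge m) (d : ℕ) :
    law ρ κ ν {x | x.2.2 e (x.time d) = 0} = law ρ κ ν {x | x.2.2 e (x.time 1) = 0} ^ d := by
  induction d with
  | zero => simp
  | succ d ih =>
    rw [add_comm d 1, ← (measurePreserving_join hν 1).measure_preimage
      (measurableSet_path_time_eq_zero e (1 + d)).nullMeasurableSet, pow_add, pow_one, ← ih,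
      ← Measure.prod_prod]
    congr 1
    ext ⟨x, y⟩
    have h : (join 1 x y).2.2 e ((join 1 x y).time (1 + d))
        = x.2.2 e (x.time 1) + y.2.2 e (y.time d) := by
      rw [time_join_add]
      exact CountingPath.splice_apply_add _ _ _ _
    simp [h]

/-- If silence were almost sure, Fubini would give a fixed length c > 0 with probability 1 of no
activation by time c, whereas it is exp (-r c) < 1. -/
lemma law_path_time_one_lt_one (hr : 0 < r) (hρ : ∀ᵐ c ∂ρ, 0 < c)
    (hν : IsPoissonCounter (fun t (x : CountingPath) => x t) r ν) (e : GossipEdge m) :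
    law ρ κ ν {x | x.2.2 e (x.time 1) = 0} < 1 := by
  refine lt_of_le_of_ne prob_le_one fun h => ?_
  have h1 : ∀ᵐ x ∂(law ρ κ ν), x.2.2 e (x.1 0) = 0 := by
    rw [← prob_compl_eq_zero_iff (measurableSet_path_time_eq_zero e 1)] at h
    rw [ae_iff]
    convert h using 2
    ext x
    simp [time]
  have hm : MeasurableSet {q : ℝ≥0 × CountingPath | q.2 q.1 = 0} :=
    (measurable_snd.countingPath_eval measurable_fst) (measurableSet_singleton 0)
  have h2 : ∀ᵐ q ∂(ρ.prod ν), q.2 q.1 = 0 := by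
    have hmp := measurePreserving_cycle_path (m := m) (ρ := ρ) (κ := κ) (ν := ν) e
    rw [← hmp.map_eq]
    exact (ae_map_iff hmp.measurable.aemeasurable hm).2 h1
  obtain ⟨c, hc, hc0⟩ := ((Measure.ae_ae_of_ae_prod h2).and hρ).exists
  have h3 : ν {x | x c = 0} = 1 := by
    rw [← measure_univ (μ := ν)]
    exact measure_congr (eventuallyEq_set.2 (hc.mono fun x hx => by simpa using hx))
  rw [hν.measure_eq_zero c, ENNReal.ofReal_eq_one, Real.exp_eq_one_iff] at h3
  have : (0 : ℝ) < r * c := by positivity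
  linarith

lemma ae_lt_card_holders {k : ℕ} (hκ : ∀ᵐ K ∂κ, k < K.card) :
    ∀ᵐ x ∂(law ρ κ ν), k < (x.2.1 0).card :=
  (measurePreserving_holders (ρ := ρ) (κ := κ) (ν := ν) 0).quasiMeasurePreserving.ae hκ

lemma lintegral_delay_ne_top {k : ℕ} (hκ : ∀ᵐ K ∂κ, k < K.card) (hr : 0 < r)
    (hν : IsPoissonCounter (fun t (x : CountingPath) => x t) r ν) (j : Fin m) :
    ∫⁻ x, delay k j x ∂(law ρ κ ν) ≠ ⊤ := by
  have h : ∫⁻ x, delay k j x ∂(law ρ κ ν) ≤ ∫⁻ x, ∑ e, firstActivation e x ∂(law ρ κ ν) :=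
    lintegral_mono_ae ((ae_lt_card_holders hκ).mono fun x hx => delay_le_sum_firstActivation j hx)
  rw [lintegral_finsetSum _ fun e _ => measurable_firstActivation e] at h
  exact ne_top_of_le_ne_top
    (ENNReal.sum_ne_top.2 fun e _ => lintegral_firstActivation_ne_top hr hν e) h

lemma lintegral_firstActivation_mul_delay_ne_top {k : ℕ} (hκ : ∀ᵐ K ∂κ, k < K.card) (hr : 0 < r)
    (hν : IsPoissonCounter (fun t (x : CountingPath) => x t) r ν) (e : GossipEdge m) (j : Fin m) :
    ∫⁻ x, firstActivation e x * delay k j x ∂(law ρ κ ν) ≠ ⊤ := by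
  have h : ∫⁻ x, firstActivation e x * delay k j x ∂(law ρ κ ν)
      ≤ ∫⁻ x, ∑ e', firstActivation e x * firstActivation e' x ∂(law ρ κ ν) :=
    lintegral_mono_ae ((ae_lt_card_holders hκ).mono fun x hx => by
      rw [← Finset.mul_sum]
      exact mul_le_mul_right (delay_le_sum_firstActivation j hx) _)
  have hm : ∀ e' : GossipEdge m,
      Measurable fun x => firstActivation e x * firstActivation e' x := fun e' =>
    (measurable_firstActivation e).mul (measurable_firstActivation e')
  rw [lintegral_finsetSum _ fun e' _ => hm e'] at h
  exact ne_top_of_le_ne_top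
    (ENNReal.sum_ne_top.2 fun e' _ => lintegral_firstActivation_mul_ne_top hr hν e e') h

/-- An expectation over the first `d` cycles and the cycles after them factors. -/
lemma lintegral_mul_shift (hν : IsPoissonCounter (fun t (x : CountingPath) => x t) r ν) (d : ℕ)
    {f g : NetworkData m → ℝ≥0∞} (hf : Measurable f) (hg : Measurable g)
    (hfd : ∀ x y, f (join d x y) = f x) :
    ∫⁻ x, f x * g (shift d x) ∂(law ρ κ ν) = (∫⁻ x, f x ∂(law ρ κ ν)) * ∫⁻ x, g x ∂(law ρ κ ν) := by
  have hm : Measurable fun x => f x * g (shift d x) := hf.mul (hg.comp (measurable_shift d))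
  rw [← (measurePreserving_join hν d).lintegral_comp hm]
  simp_rw [shift_join, hfd]
  exact lintegral_prod_mul hf.aemeasurable hg.aemeasurable

/-- The correlations of the decryption delays are summable. -/
theorem exists_summable_correlation {k : ℕ} (hκ : ∀ᵐ K ∂κ, k < K.card) (hr : 0 < r)
    (hρ : ∀ᵐ c ∂ρ, 0 < c) (hν : IsPoissonCounter (fun t (x : CountingPath) => x t) r ν)
    (j : Fin m) :
    ∃ η : ℕ → ℝ≥0∞, ∑' d, η d ≠ ⊤ ∧ ∀ d,
      ∫⁻ x, delay k j x * delay k j (shift d x) ∂(law ρ κ ν)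
        ≤ (∫⁻ x, delay k j x ∂(law ρ κ ν)) ^ 2 + η d ∧
      ∫⁻ x, delay k j x ∂(law ρ κ ν) ≤ ∫⁻ x, delayBefore k j d x ∂(law ρ κ ν) + η d := by
  classical
  let p : GossipEdge m → ℝ≥0∞ := fun e => law ρ κ ν {x | x.2.2 e (x.time 1) = 0}
  let E1 : GossipEdge m → ℝ≥0∞ := fun e => ∫⁻ x, firstActivation e x ∂(law ρ κ ν)
  let E2 : GossipEdge m → ℝ≥0∞ := fun e => ∫⁻ x, firstActivation e x * delay k j x ∂(law ρ κ ν)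
  have hmd := measurable_delay k j
  have hmi : ∀ (e : GossipEdge m) (d : ℕ), Measurable
      (({x | x.2.2 e (x.time d) = 0} : Set (NetworkData m)).indicator (1 : NetworkData m → ℝ≥0∞)) :=
    fun e d => measurable_one.indicator (measurableSet_path_time_eq_zero e d)
  have hfact : ∀ (e : GossipEdge m) (d : ℕ) (g : NetworkData m → ℝ≥0∞), Measurable g →
      ∫⁻ x, ({x | x.2.2 e (x.time d) = 0} : Set (NetworkData m)).indicator 1 x * g (shift d x)
        ∂(law ρ κ ν) = p e ^ d * ∫⁻ x, g x ∂(law ρ κ ν) := fun e d g hg => by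
    rw [lintegral_mul_shift hν d (hmi e d) hg, lintegral_indicator_one
      (measurableSet_path_time_eq_zero e d), law_path_time_eq_zero hν e d]
    intro x y
    have h : (join d x y).2.2 e ((join d x y).time d) = x.2.2 e (x.time d) := by
      rw [time_join_of_le x y le_rfl]
      exact CountingPath.splice_apply_of_le _ _ le_rfl
    simp only [Set.indicator_apply, Set.mem_ofPred_eq, h]
    rfl
  -- `p e ^ d` is the probability that e is silent for d cycles. `E2` pays for the correlation and
  -- `E1` for the truncation, so that one summable sequence serves both.
  refine ⟨fun d => ∑ e, p e ^ d * (E1 e + E2 e), ?_, fun d => ⟨?_, ?_⟩⟩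
  · rw [Summable.tsum_finsetSum fun _ _ => ENNReal.summable]
    refine ENNReal.sum_ne_top.2 fun e _ => ?_
    rw [ENNReal.tsum_mul_right, ENNReal.tsum_geometric]
    refine ENNReal.mul_ne_top (ENNReal.inv_ne_top.2 ?_) (ENNReal.add_ne_top.2
      ⟨lintegral_firstActivation_ne_top hr hν e,
        lintegral_firstActivation_mul_delay_ne_top hκ hr hν e j⟩)
    exact (tsub_pos_of_lt (law_path_time_one_lt_one hr hρ hν e)).ne'
  -- Only the unshifted factor is split at the d-th update. Its first part and the silence
  -- indicators belong to the past, everything multiplied with them to the shifted network, so each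
  -- expectation factors.
  · have h1 : ∫⁻ x, delay k j x * delay k j (shift d x) ∂(law ρ κ ν)
        ≤ ∫⁻ x, (delayBefore k j d x * delay k j (shift d x) + ∑ e,
          ({x | x.2.2 e (x.time d) = 0} : Set (NetworkData m)).indicator 1 x *
            (firstActivation e (shift d x) * delay k j (shift d x))) ∂(law ρ κ ν) :=
      lintegral_mono_ae ((ae_lt_card_holders hκ).mono fun x hx => by
        simp_rw [← mul_assoc]
        rw [← Finset.sum_mul, ← add_mul]
        exact mul_le_mul_left (delay_le_delayBefore_add j hx d) _)
    refine h1.trans ?_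
    have hm1 : Measurable fun x => delayBefore k j d x * delay k j (shift d x) :=
      (measurable_delayBefore k j d).mul (hmd.comp (measurable_shift d))
    have hm2 : ∀ e : GossipEdge m, Measurable fun x =>
        ({x | x.2.2 e (x.time d) = 0} : Set (NetworkData m)).indicator 1 x *
          (firstActivation e (shift d x) * delay k j (shift d x)) := fun e =>
      (hmi e d).mul (((measurable_firstActivation e).comp (measurable_shift d)).mul
        (hmd.comp (measurable_shift d)))
    rw [lintegral_add_left hm1,
      lintegral_mul_shift hν d (measurable_delayBefore k j d) hmd (delayBefore_join k j d),
      lintegral_finsetSum _ fun e _ => hm2 e]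
    refine add_le_add ?_ (Finset.sum_le_sum fun e _ => ?_)
    · rw [sq]
      exact mul_le_mul_left (lintegral_mono (delayBefore_le_delay k j d)) _
    · rw [hfact e d (fun x => firstActivation e x * delay k j x)
        ((measurable_firstActivation e).mul hmd)]
      exact mul_le_mul_right le_add_self _
  · have h1 : ∫⁻ x, delay k j x ∂(law ρ κ ν)
        ≤ ∫⁻ x, (delayBefore k j d x + ∑ e,
          ({x | x.2.2 e (x.time d) = 0} : Set (NetworkData m)).indicator 1 x *
            firstActivation e (shift d x)) ∂(law ρ κ ν) :=
      lintegral_mono_ae ((ae_lt_card_holders hκ).mono fun x hx => delay_le_delayBefore_add j hx d)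
    refine h1.trans ?_
    have hm : ∀ e : GossipEdge m, Measurable fun x =>
        ({x | x.2.2 e (x.time d) = 0} : Set (NetworkData m)).indicator 1 x *
          firstActivation e (shift d x) := fun e =>
      (hmi e d).mul ((measurable_firstActivation e).comp (measurable_shift d))
    rw [lintegral_add_left (measurable_delayBefore k j d), lintegral_finsetSum _ fun e _ => hm e]
    refine add_le_add_right (Finset.sum_le_sum fun e _ => ?_) _
    rw [hfact e d _ (measurable_firstActivation e)]
    exact mul_le_mul_right le_self_add _

end NetworkData

/-! ### A law of large numbers for weakly correlated variables -/

lemma MeasureTheory.ae_tendsto_zero_of_tsum_lintegral_ne_top {Ω : Type*} [MeasurableSpace Ω]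
    {μ : Measure Ω} {f : ℕ → Ω → ℝ≥0∞} (hf : ∀ n, Measurable (f n))
    (h : ∑' n, ∫⁻ ω, f n ω ∂μ ≠ ⊤) : ∀ᵐ ω ∂μ, Tendsto (fun n => f n ω) atTop (𝓝 0) := by
  rw [← lintegral_tsum fun n => (hf n).aemeasurable] at h
  filter_upwards [ae_lt_top (Measurable.tsum hf) h] with ω hω
  exact ENNReal.tendsto_atTop_zero_of_tsum_ne_top hω.ne

/-- The argument of η is the distance from i to j, and each distance occurs at most once on either
side of i. -/
lemma ENNReal.sum_dist_le_two_mul_tsum (η : ℕ → ℝ≥0∞) (i n : ℕ) :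
    ∑ j ∈ Finset.range n, η (max i j - min i j) ≤ 2 * ∑' d, η d := by
  classical
  have key : ∀ s : Finset ℕ, Set.InjOn (fun j => max i j - min i j) s →
      ∑ j ∈ s, η (max i j - min i j) ≤ ∑' d, η d := fun s hs => by
    rw [← Finset.sum_image (f := η) hs]
    exact ENNReal.sum_le_tsum _
  rw [← Finset.sum_filter_add_sum_filter_not (Finset.range n) (· ≤ i), two_mul]
  refine add_le_add (key _ fun a ha b hb hab => ?_) (key _ fun a ha b hb hab => ?_)
  · have h1 := (Finset.mem_filter.1 ha).2
    have h2 := (Finset.mem_filter.1 hb).2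
    simp only at hab
    omega
  · have h1 := (Finset.mem_filter.1 ha).2
    have h2 := (Finset.mem_filter.1 hb).2
    simp only at hab
    omega

lemma MeasureTheory.lintegral_sum_sq_le {Ω : Type*} [MeasurableSpace Ω] {μ : Measure Ω}
    {Z : ℕ → Ω → ℝ≥0∞} (hZ : ∀ l, Measurable (Z l)) {a : ℝ≥0∞} {η : ℕ → ℝ≥0∞}
    (hcorr : ∀ l d, ∫⁻ ω, Z l ω * Z (l + d) ω ∂μ ≤ a ^ 2 + η d) (n : ℕ) :
    ∫⁻ ω, (∑ l ∈ Finset.range n, Z l ω) ^ 2 ∂μ ≤ (n * a) ^ 2 + n * (2 * ∑' d, η d) := by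
  have hm : ∀ i j, Measurable fun ω => Z i ω * Z j ω := fun i j => (hZ i).mul (hZ j)
  simp_rw [sq (∑ l ∈ Finset.range n, Z l _), Finset.sum_mul_sum]
  rw [lintegral_finsetSum _ fun i _ => Finset.measurable_fun_sum _ fun j _ => hm i j]
  simp_rw [lintegral_finsetSum _ fun j _ => hm _ j]
  have hij : ∀ i j, ∫⁻ ω, Z i ω * Z j ω ∂μ ≤ a ^ 2 + η (max i j - min i j) := fun i j => by
    rcases le_total i j with h | h
    · have := hcorr i (j - i)
      rw [Nat.add_sub_cancel' h] at this
      rwa [max_eq_right h, min_eq_left h]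
    · have := hcorr j (i - j)
      rw [Nat.add_sub_cancel' h] at this
      simp_rw [mul_comm (Z i _)]
      rwa [max_eq_left h, min_eq_right h]
  calc ∑ i ∈ Finset.range n, ∑ j ∈ Finset.range n, ∫⁻ ω, Z i ω * Z j ω ∂μ
      ≤ ∑ i ∈ Finset.range n, ∑ j ∈ Finset.range n, (a ^ 2 + η (max i j - min i j)) :=
        Finset.sum_le_sum fun i _ => Finset.sum_le_sum fun j _ => hij i j
    _ ≤ ∑ i ∈ Finset.range n, (n * a ^ 2 + 2 * ∑' d, η d) := Finset.sum_le_sum fun i _ => by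
        rw [Finset.sum_add_distrib, Finset.sum_const, Finset.card_range, nsmul_eq_mul]
        gcongr
        exact ENNReal.sum_dist_le_two_mul_tsum η i n
    _ = (n * a) ^ 2 + n * (2 * ∑' d, η d) := by
        rw [Finset.sum_const, Finset.card_range, nsmul_eq_mul]
        ring

/-- Monotone nonnegative variables which are asymptotically at most sums of variables of mean `a`
with summable correlations, and whose means are close to those of the sums, grow like `a * n`. -/
theorem MeasureTheory.ae_tendsto_div_of_correlation {Ω : Type*} [MeasurableSpace Ω] {μ : Measure Ω}
    [IsProbabilityMeasure μ] {Z V : ℕ → Ω → ℝ≥0∞} (hZ : ∀ l, Measurable (Z l))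
    (hV : ∀ n, Measurable (V n)) {a C : ℝ≥0∞} {η : ℕ → ℝ≥0∞} (ha : a ≠ ⊤) (hC : C ≠ ⊤)
    (hη : ∑' d, η d ≠ ⊤) (hcorr : ∀ l d, ∫⁻ ω, Z l ω * Z (l + d) ω ∂μ ≤ a ^ 2 + η d)
    (hVZ : ∀ n ω, V n ω ≤ ∑ l ∈ Finset.range n, Z l ω) (hmono : ∀ ω, Monotone fun n => V n ω)
    (hlow : ∀ n : ℕ, n * a ≤ ∫⁻ ω, V n ω ∂μ + C) :
    ∀ᵐ ω ∂μ, Tendsto (fun n : ℕ => (V n ω).toReal / n) atTop (𝓝 a.toReal) := by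
  let R : ℝ := (2 * ∑' d, η d).toReal
  have hsq : ∀ n, ∫⁻ ω, V n ω ^ 2 ∂μ ≤ (n * a) ^ 2 + n * (2 * ∑' d, η d) := fun n =>
    (lintegral_mono fun ω => pow_le_pow_left' (hVZ n ω) 2).trans (lintegral_sum_sq_le hZ hcorr n)
  have hR : (2 * ∑' d, η d) ≠ ⊤ := ENNReal.mul_ne_top (by simp) hη
  have hbound : ∀ n : ℕ, ((n : ℝ≥0∞) * a) ^ 2 + n * (2 * ∑' d, η d) ≠ ⊤ := fun n =>
    ENNReal.add_ne_top.2 ⟨ENNReal.pow_ne_top (ENNReal.mul_ne_top (by simp) ha),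
      ENNReal.mul_ne_top (by simp) hR⟩
  have hsqfin : ∀ n, ∫⁻ ω, V n ω ^ 2 ∂μ ≠ ⊤ := fun n => ne_top_of_le_ne_top (hbound n) (hsq n)
  have hfin : ∀ n, ∀ᵐ ω ∂μ, V n ω < ⊤ := fun n => by
    filter_upwards [ae_lt_top ((hV n).pow_const 2) (hsqfin n)] with ω hω
    exact (ENNReal.pow_lt_top_iff.1 hω).resolve_right (by simp)
  let W : ℕ → Ω → ℝ := fun n ω => (V n ω).toReal
  have hW : ∀ n, Measurable (W n) := fun n => (hV n).ennreal_toReal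
  have hW2 : ∀ n, Integrable (fun ω => W n ω ^ 2) μ := fun n => by
    have := integrable_toReal_of_lintegral_ne_top ((hV n).pow_const 2).aemeasurable (hsqfin n)
    simpa [W, ENNReal.toReal_pow] using this
  have hW1 : ∀ n, Integrable (W n) μ := fun n =>
    ((memLp_two_iff_integrable_sq (hW n).aestronglyMeasurable).2 (hW2 n)).integrable (by norm_num)
  have hEW2 : ∀ n : ℕ, ∫ ω, W n ω ^ 2 ∂μ ≤ (n * a.toReal) ^ 2 + n * R := fun n => by
    have h1 := integral_toReal ((hV n).pow_const 2).aemeasurable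
      (ae_lt_top ((hV n).pow_const 2) (hsqfin n))
    have h2 := ENNReal.toReal_mono (hbound n) (hsq n)
    rw [← h1, ENNReal.toReal_add (ENNReal.pow_ne_top (ENNReal.mul_ne_top (by simp) ha))
      (ENNReal.mul_ne_top (by simp) hR)] at h2
    simpa [W, R, ENNReal.toReal_pow, ENNReal.toReal_mul] using h2
  have hEW : ∀ n : ℕ, n * a.toReal ≤ ∫ ω, W n ω ∂μ + C.toReal := fun n => by
    have h1 := integral_toReal (hV n).aemeasurable (hfin n)
    have h3 : ∫⁻ ω, V n ω ∂μ ≠ ⊤ := fun h => by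
      have := (hasFiniteIntegral_iff_enorm.1 (hW1 n).2)
      rw [lintegral_congr_ae (g := V n)] at this
      · exact this.ne h
      · filter_upwards [hfin n] with ω hω
        rw [Real.enorm_of_nonneg ENNReal.toReal_nonneg, ENNReal.ofReal_toReal hω.ne]
    have h2 := ENNReal.toReal_mono (ENNReal.add_ne_top.2 ⟨h3, hC⟩) (hlow n)
    rw [ENNReal.toReal_add h3 hC, ← h1, ENNReal.toReal_mul, ENNReal.toReal_natCast] at h2
    exact h2
  -- With W of mean at least n a - C and second moment at most (n a)² + n R, expanding (W - n a)²
  -- leaves at most n (R + 2 a C).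
  let D : ℝ := R + 2 * a.toReal * C.toReal
  have hvar : ∀ n : ℕ, ∫ ω, (W n ω - n * a.toReal) ^ 2 ∂μ ≤ n * D := fun n => by
    have h1 : ∀ ω, (W n ω - n * a.toReal) ^ 2
        = W n ω ^ 2 - 2 * (n * a.toReal) * W n ω + (n * a.toReal) ^ 2 := fun ω => by ring
    simp_rw [h1]
    have hW3 : Integrable (fun ω => W n ω ^ 2 - 2 * (n * a.toReal) * W n ω) μ :=
      (hW2 n).sub ((hW1 n).const_mul _)
    rw [integral_add hW3 (integrable_const _),
      integral_sub (hW2 n) ((hW1 n).const_mul _), integral_const_mul, integral_const, probReal_univ,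
      one_smul]
    have h2 : 0 ≤ (n : ℝ) * a.toReal := by positivity
    have := mul_le_mul_of_nonneg_left (hEW n) h2
    have := hEW2 n
    simp only [D]
    nlinarith
  have hD : 0 ≤ D := by
    have := (integral_nonneg fun ω => sq_nonneg (W 1 ω - (1 : ℕ) * a.toReal)).trans (hvar 1)
    simpa using this
  -- Along the squares the mean square error of W n / n is at most D / (i + 1)², which is summable.
  let c : ℕ → ℕ := fun i => (i + 1) ^ 2
  have hc0 : ∀ i, (0 : ℝ) < c i := fun i => by positivity
  have hae : ∀ᵐ ω ∂μ, Tendsto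
      (fun i => ENNReal.ofReal ((W (c i) ω / c i - a.toReal) ^ 2)) atTop (𝓝 0) := by
    refine ae_tendsto_zero_of_tsum_lintegral_ne_top
      (fun i => ((((hW _).div_const _).sub_const _).pow_const 2).ennreal_ofReal) ?_
    have hle : ∀ i, ∫⁻ ω, ENNReal.ofReal ((W (c i) ω / c i - a.toReal) ^ 2) ∂μ
        ≤ ENNReal.ofReal (D * (1 / ((i + 1 : ℕ) : ℝ) ^ 2)) := fun i => by
      have h1 : ∀ ω, (W (c i) ω / c i - a.toReal) ^ 2
          = (1 / (c i : ℝ) ^ 2) * (W (c i) ω - c i * a.toReal) ^ 2 := fun ω => by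
        have := (hc0 i).ne'
        field_simp
      have hint : Integrable (fun ω => (W (c i) ω - c i * a.toReal) ^ 2) μ := by
        have hmem := (memLp_two_iff_integrable_sq (hW (c i)).aestronglyMeasurable).2 (hW2 (c i))
        exact (hmem.sub (memLp_const _)).integrable_sq
      simp_rw [h1]
      rw [← ofReal_integral_eq_lintegral_ofReal (hint.const_mul _)
        (ae_of_all _ fun ω => by positivity), integral_const_mul]
      refine ENNReal.ofReal_le_ofReal ?_
      calc 1 / (c i : ℝ) ^ 2 * ∫ ω, (W (c i) ω - c i * a.toReal) ^ 2 ∂μ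
          ≤ 1 / (c i : ℝ) ^ 2 * (c i * D) :=
            mul_le_mul_of_nonneg_left (hvar (c i)) (by positivity)
        _ = D * (1 / ((i + 1 : ℕ) : ℝ) ^ 2) := by
            simp only [c]
            push_cast
            field_simp
    refine ne_top_of_le_ne_top ?_ (ENNReal.tsum_le_tsum hle)
    have hsum : Summable fun i : ℕ => D * (1 / ((i + 1 : ℕ) : ℝ) ^ 2) :=
      ((summable_nat_add_iff 1).2 (Real.summable_one_div_nat_pow.2 one_lt_two)).mul_left D
    rw [← ENNReal.ofReal_tsum_of_nonneg (fun i => by positivity) hsum]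
    exact ENNReal.ofReal_ne_top
  filter_upwards [hae, ae_all_iff.2 hfin] with ω hω hfinω
  -- Monotonicity fills the gaps: the ratio of consecutive squares tends to 1, so this subsequence
  -- works for every b > 1.
  refine tendsto_div_of_monotone_of_exists_subseq_tendsto_div _ _
    (fun p q hpq => ENNReal.toReal_mono (hfinω q).ne (hmono ω hpq)) fun b hb => ⟨c, ?_, ?_, ?_⟩
  · have h1 : Tendsto (fun i : ℕ => (1 + 1 / ((i : ℝ) + 1)) ^ 2) atTop (𝓝 ((1 + 0) ^ 2)) :=
      (tendsto_one_div_add_atTop_nhds_zero_nat.const_add 1).pow 2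
    have h2 := h1.eventually (gt_mem_nhds (by simpa using hb))
    filter_upwards [h2] with i hi
    have h3 : (c (i + 1) : ℝ) = (1 + 1 / ((i : ℝ) + 1)) ^ 2 * c i := by
      simp only [c]
      push_cast
      field_simp
    rw [h3]
    exact mul_le_mul_of_nonneg_right hi.le (hc0 i).le
  · exact tendsto_atTop_mono (fun i => by simp only [c, id]; nlinarith) tendsto_id
  · have h1 := (ENNReal.tendsto_toReal ENNReal.zero_ne_top).comp hω
    simp only [Function.comp_def, ENNReal.toReal_zero] at h1
    have h2 : Tendsto (fun i => (W (c i) ω / c i - a.toReal) ^ 2) atTop (𝓝 0) :=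
      h1.congr fun i => ENNReal.toReal_ofReal (sq_nonneg _)
    have h3 := h2.sqrt
    simp only [Real.sqrt_sq_eq_abs, Real.sqrt_zero] at h3
    exact tendsto_sub_nhds_zero_iff.1 ((tendsto_zero_iff_abs_tendsto_zero _).2 h3)

/-! ### Time averages -/

/-- A monotone function which grows linearly along a sequence of times which grows linearly grows
linearly. -/
lemma tendsto_div_of_tendsto_div_times {F : ℝ → ℝ} {t : ℕ → ℝ} {a c : ℝ} (hF : MonotoneOn F (Set.Ici 0))
    (hF0 : ∀ T, 0 ≤ T → 0 ≤ F T) (ht0 : t 0 = 0) (htm : Monotone t) (hc : 0 < c)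
    (ht : Tendsto (fun n : ℕ => t n / n) atTop (𝓝 c))
    (hFt : Tendsto (fun n : ℕ => F (t (n + 1)) / n) atTop (𝓝 a)) :
    Tendsto (fun T => F T / T) atTop (𝓝 (a / c)) := by
  have htop : Tendsto t atTop atTop := by
    have h := ht.pos_mul_atTop hc tendsto_natCast_atTop_atTop
    refine h.congr' ?_
    filter_upwards [eventually_gt_atTop 0] with n hn
    have : (n : ℝ) ≠ 0 := by positivity
    field_simp
  have hex : ∀ T, 0 ≤ T → ∃ n, t n ≤ T ∧ T < t (n + 1) := fun T hT => by
    classical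
    have h : ∃ n, T < t n := (htop.eventually_gt_atTop T).exists
    have hpos : Nat.find h ≠ 0 := fun h0 => by
      have := Nat.find_spec h
      rw [h0, ht0] at this
      exact absurd hT (not_le.2 this)
    refine ⟨Nat.find h - 1, not_lt.1 (Nat.find_min h (Nat.sub_one_lt hpos)), ?_⟩
    rw [Nat.sub_add_cancel (Nat.one_le_iff_ne_zero.2 hpos)]
    exact Nat.find_spec h
  -- `N T` is the cycle containing T; F T / T then lies between F (t N) / t (N + 1) and F (t (N +
  -- 1)) / t N, and both have limit a / c.
  choose! N hN1 hN2 using hex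
  have hNtop : Tendsto N atTop atTop := by
    refine tendsto_atTop.2 fun b => ?_
    filter_upwards [eventually_ge_atTop (t b), eventually_ge_atTop 0] with T hT hT0
    by_contra hlt
    exact absurd (hT.trans_lt (hN2 T hT0)) (not_lt.2 (htm (by omega)))
  have hinv : Tendsto (fun n : ℕ => (n : ℝ) / t n) atTop (𝓝 c⁻¹) :=
    (ht.inv₀ hc.ne').congr fun n => inv_div _ _
  have hup : Tendsto (fun n : ℕ => F (t (n + 1)) / t n) atTop (𝓝 (a / c)) := by
    refine (hFt.mul hinv).congr' ?_
    filter_upwards [eventually_gt_atTop 0] with n hn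
    have : (n : ℝ) ≠ 0 := by positivity
    field_simp
  have hlow : Tendsto (fun n : ℕ => F (t n) / t (n + 1)) atTop (𝓝 (a / c)) := by
    have h1 : Tendsto (fun n : ℕ => F (t (n + 1)) / t (n + 2)) atTop (𝓝 (a / c)) := by
      have h2 := (tendsto_add_atTop_iff_nat 2).2 hinv
      have h3 : Tendsto (fun n : ℕ => (n : ℝ) / ((n + 2 : ℕ) : ℝ)) atTop (𝓝 1) := by
        have := tendsto_natCast_div_add_atTop (2 : ℝ)
        simpa using this
      have h4 := (hFt.mul h3).mul h2
      rw [mul_one] at h4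
      refine h4.congr' ?_
      filter_upwards [eventually_gt_atTop 0] with n hn
      have : (n : ℝ) ≠ 0 := by positivity
      have : ((n + 2 : ℕ) : ℝ) ≠ 0 := by positivity
      field_simp
    exact (tendsto_add_atTop_iff_nat 1).1 h1
  refine tendsto_of_tendsto_of_tendsto_of_le_of_le' (hlow.comp hNtop) (hup.comp hNtop) ?_ ?_
  · filter_upwards [eventually_gt_atTop 0] with T hT
    have h0 : 0 ≤ t (N T) := ht0 ▸ htm (Nat.zero_le _)
    exact div_le_div₀ (hF0 T hT.le) (hF h0 hT.le (hN1 T hT.le)) hT (hN2 T hT.le).le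
  · filter_upwards [eventually_gt_atTop 0, eventually_ge_atTop (t 0),
      (htop.comp hNtop).eventually_gt_atTop 0] with T hT _ hpos
    have h0 : 0 ≤ t (N T + 1) := ht0 ▸ htm (Nat.zero_le _)
    exact div_le_div₀ (hF0 _ h0) (hF hT.le h0 (hN2 T hT.le).le) hpos (hN1 T hT.le)

namespace NetworkData

variable {m : ℕ}

/-- The total time before the `(n + 1)`-st update during which the versions `1, …, n` count for the
age of node `j`. -/
noncomputable def totalDelay (k : ℕ) (j : Fin m) (n : ℕ) (x : NetworkData m) : ℝ≥0∞ :=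
  ∑ l ∈ Finset.range n, delayBefore k j (n - l) (shift (l + 1) x)

lemma delayBefore_mono (k : ℕ) (j : Fin m) {d d' : ℕ} (h : d ≤ d') (x : NetworkData m) :
    delayBefore k j d x ≤ delayBefore k j d' x :=
  measure_mono fun _ hu => ⟨hu.1.trans_le (x.monotone_time h), hu.2⟩

/-- The law of large numbers applies with the stationary full delays as the dominating terms.
Truncating version l + 1 after n - l cycles costs at most η (n - l) in mean, so the total loss is at
most the sum of η, uniformly in n. -/
theorem ae_tendsto_totalDelay {ρ : Measure ℝ≥0} {κ : Measure (Finset (Fin m))}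
    {ν : Measure CountingPath} [IsProbabilityMeasure ρ] [IsProbabilityMeasure κ]
    [IsProbabilityMeasure ν] {r : ℝ≥0} {k : ℕ} (hκ : ∀ᵐ K ∂κ, k < K.card) (hr : 0 < r)
    (hρ : ∀ᵐ c ∂ρ, 0 < c) (hν : IsPoissonCounter (fun t (x : CountingPath) => x t) r ν)
    (j : Fin m) :
    ∀ᵐ x ∂(law ρ κ ν), Tendsto (fun n : ℕ => (totalDelay k j n x).toReal / n) atTop
      (𝓝 (∫⁻ x, delay k j x ∂(law ρ κ ν)).toReal) := by
  obtain ⟨η, hη, hcorr⟩ := exists_summable_correlation (κ := κ) hκ hr hρ hν j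
  have hshift : ∀ d {f : NetworkData m → ℝ≥0∞}, Measurable f →
      ∫⁻ x, f (shift d x) ∂(law ρ κ ν) = ∫⁻ x, f x ∂(law ρ κ ν) := fun d f hf =>
    (measurePreserving_shift hν d).lintegral_comp hf
  have hmd := measurable_delay k j
  have hmb : ∀ n l, Measurable fun x => delayBefore k j (n - l) (shift (l + 1) x) := fun n l =>
    (measurable_delayBefore k j _).comp (measurable_shift _)
  refine ae_tendsto_div_of_correlation (Z := fun l x => delay k j (shift (l + 1) x)) (η := η)
    (C := ∑' d, η d) (fun l => hmd.comp (measurable_shift _))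
    (fun n => Finset.measurable_fun_sum _ fun l _ => hmb n l)
    (lintegral_delay_ne_top hκ hr hν j) hη hη (fun l d => ?_)
    (fun n x => Finset.sum_le_sum fun l _ => delayBefore_le_delay _ _ _ _)
    (fun x n n' hn => ?_) (fun n => ?_)
  · have h1 : ∀ x : NetworkData m, shift (l + d + 1) x = shift d (shift (l + 1) x) := fun x => by
      rw [shift_shift]
      congr 1
      omega
    simp_rw [h1]
    have hm : Measurable fun x => delay k j x * delay k j (shift d x) :=
      hmd.mul (hmd.comp (measurable_shift d))
    rw [hshift (l + 1) hm]
    exact (hcorr d).1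
  · exact (Finset.sum_le_sum fun l _ => delayBefore_mono k j (by omega) _).trans
      (Finset.sum_le_sum_of_subset (Finset.range_mono hn))
  · rw [lintegral_finsetSum _ fun l _ => hmb n l]
    have hs : ∀ l, ∫⁻ x, delayBefore k j (n - l) (shift (l + 1) x) ∂(law ρ κ ν)
        = ∫⁻ x, delayBefore k j (n - l) x ∂(law ρ κ ν) := fun l =>
      hshift _ (measurable_delayBefore k j _)
    simp_rw [hs]
    calc (n : ℝ≥0∞) * ∫⁻ x, delay k j x ∂(law ρ κ ν)
        = ∑ l ∈ Finset.range n, ∫⁻ x, delay k j x ∂(law ρ κ ν) := by simp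
      _ ≤ ∑ l ∈ Finset.range n, (∫⁻ x, delayBefore k j (n - l) x ∂(law ρ κ ν) + η (n - l)) :=
          Finset.sum_le_sum fun l _ => (hcorr (n - l)).2
      _ ≤ _ := by
          rw [Finset.sum_add_distrib]
          gcongr
          rw [← Finset.sum_image (f := η) (g := fun l => n - l)]
          · exact ENNReal.sum_le_tsum _
          · intro a ha b hb hab
            have h1 := Finset.mem_range.1 ha
            have h2 := Finset.mem_range.1 hb
            simp only at hab
            omega

/-- The times after the `l`-th update at which the node `j` has at most `k` keys of each of the
versions from `l` on. -/
def outdated (k : ℕ) (j : Fin m) (x : NetworkData m) (l : ℕ) : Set ℝ :=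
  {t | x.time l ≤ t ∧ Undecrypted k j (shift l x) (t - x.time l).toNNReal}

lemma measurableSet_outdated (k : ℕ) (j : Fin m) (x : NetworkData m) (l : ℕ) :
    MeasurableSet (outdated k j x l) := by
  have h : Measurable fun t : ℝ => (shift l x, t - x.time l) :=
    measurable_const.prodMk (measurable_id.sub_const _)
  exact measurableSet_Ici.inter (h (measurableSet_undecrypted k j))

lemma volume_outdated (k : ℕ) (j : Fin m) (x : NetworkData m) (l d : ℕ) :
    volume (outdated k j x l ∩ Set.Iio (x.time (l + d) : ℝ)) = delayBefore k j d (shift l x) := by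
  unfold delayBefore
  have hm : MeasurableSet {u : ℝ | u < (shift l x).time d ∧
      Undecrypted k j (shift l x) u.toNNReal} :=
    measurable_prodMk_left (measurableSet_undecrypted_before k j d)
  rw [Measure.restrict_apply hm, ← measure_preimage_add_right volume (-(x.time l : ℝ)) (_ ∩ Set.Ici 0)]
  congr 1
  ext t
  have h1 : t < x.time (l + d) ↔ t + -(x.time l : ℝ) < (shift l x).time d := by
    rw [← time_shift, NNReal.coe_add, ← sub_eq_add_neg, sub_lt_iff_lt_add']
  simp only [outdated, Set.mem_inter_iff, Set.mem_ofPred_eq, Set.mem_Iio, Set.mem_preimage,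
    Set.mem_Ici, h1, ← sub_eq_add_neg, sub_nonneg]
  tauto

variable {k : ℕ} {j : Fin m} {x : NetworkData m} {A : ℝ≥0 → ℝ}

open Classical in
/-- `A` counts the versions from `1` on which are outdated. -/
def IsAge (k : ℕ) (j : Fin m) (x : NetworkData m) (A : ℝ≥0 → ℝ) : Prop :=
  ∀ n t, t < x.time (n + 1) →
    A t = (((Finset.range n).filter fun l => (t : ℝ) ∈ outdated k j x (l + 1)).card : ℝ)

lemma IsAge.eq_sum (hA : IsAge k j x A) {n : ℕ} {u : ℝ} (hu : u ∈ Set.Ico 0 (x.time (n + 1) : ℝ)) :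
    A u.toNNReal = ∑ l ∈ Finset.range n, (outdated k j x (l + 1)).indicator 1 u := by
  classical
  rw [hA n u.toNNReal ((Real.toNNReal_lt_iff_lt_coe hu.1).2 hu.2), Real.coe_toNNReal _ hu.1,
    Finset.card_filter]
  push_cast
  exact Finset.sum_congr rfl fun l _ => by simp [Set.indicator_apply]

lemma IsAge.nonneg (hA : IsAge k j x A) (htop : Tendsto (fun n => (x.time n : ℝ)) atTop atTop)
    (u : ℝ≥0) : 0 ≤ A u := by
  obtain ⟨n, hn⟩ := (((tendsto_add_atTop_iff_nat 1).2 htop).eventually_gt_atTop (u : ℝ)).exists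
  rw [hA n u (by exact_mod_cast hn)]
  positivity

lemma IsAge.intervalIntegrable (hA : IsAge k j x A) {n : ℕ} {T : ℝ} (hT0 : 0 ≤ T)
    (hT : T ≤ x.time (n + 1)) :
    IntervalIntegrable (fun u : ℝ => A u.toNNReal) volume 0 T := by
  rw [intervalIntegrable_iff_integrableOn_Ico_of_le hT0]
  have h : IntegrableOn (fun u => ∑ l ∈ Finset.range n,
      (outdated k j x (l + 1)).indicator (1 : ℝ → ℝ) u) (Set.Ico 0 T) :=
    integrable_finsetSum _ fun l _ =>
      (integrable_const (1 : ℝ)).indicator (measurableSet_outdated k j x _)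
  exact h.congr_fun (fun u hu => (hA.eq_sum ⟨hu.1, hu.2.trans_le hT⟩).symm) measurableSet_Ico

/-- Integrates the count term by term; the term of version l + 1 is the measure of its outdated
times before the (n + 1)-st update, n - l cycles later. -/
lemma IsAge.integral_eq (hA : IsAge k j x A) (n : ℕ) :
    ∫ u in (0 : ℝ)..x.time (n + 1), A u.toNNReal = (totalDelay k j n x).toReal := by
  rw [intervalIntegral.integral_of_le (NNReal.coe_nonneg _), ← integral_Ico_eq_integral_Ioc,
    setIntegral_congr_fun measurableSet_Ico fun u hu => hA.eq_sum hu]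
  have hi : ∀ l, Integrable ((outdated k j x (l + 1)).indicator (1 : ℝ → ℝ))
      (volume.restrict (Set.Ico 0 (x.time (n + 1) : ℝ))) := fun l =>
    (integrable_const (1 : ℝ)).indicator (measurableSet_outdated k j x _)
  rw [integral_finsetSum _ fun l _ => hi l]
  have h1 : ∀ l ∈ Finset.range n, volume (outdated k j x (l + 1) ∩
      Set.Ico 0 (x.time (n + 1) : ℝ)) = delayBefore k j (n - l) (shift (l + 1) x) := fun l hl => by
    rw [← volume_outdated, show l + 1 + (n - l) = n + 1 by
      have := Finset.mem_range.1 hl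
      omega]
    congr 1
    ext t
    simp only [outdated, Set.mem_inter_iff, Set.mem_ofPred_eq, Set.mem_Ico, Set.mem_Iio]
    refine ⟨fun h => ⟨h.1, h.2.2⟩, fun h => ⟨h.1, (NNReal.coe_nonneg _).trans h.1.1, h.2⟩⟩
  unfold totalDelay
  rw [ENNReal.toReal_sum fun l hl => ?_]
  · refine Finset.sum_congr rfl fun l hl => ?_
    rw [integral_indicator_one (measurableSet_outdated k j x _), measureReal_def,
      Measure.restrict_apply (measurableSet_outdated k j x _), h1 l hl]
  · rw [← h1 l hl]
    exact ne_top_of_le_ne_top (by simp) (measure_mono Set.inter_subset_right)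

/-- A renewal-reward argument: the integral grows by a per cycle and time by c per cycle.
Nonnegativity of the age makes the integral monotone, which handles times between updates. -/
theorem IsAge.isTimeAverage (hA : IsAge k j x A) {a c : ℝ} (hc : 0 < c)
    (ht : Tendsto (fun n : ℕ => (x.time n : ℝ) / n) atTop (𝓝 c))
    (ha : Tendsto (fun n : ℕ => (totalDelay k j n x).toReal / n) atTop (𝓝 a)) :
    IsTimeAverage A (a / c) := by
  have htop : Tendsto (fun n => (x.time n : ℝ)) atTop atTop := by
    have h := ht.pos_mul_atTop hc tendsto_natCast_atTop_atTop
    refine h.congr' ?_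
    filter_upwards [eventually_gt_atTop 0] with n hn
    have : (n : ℝ) ≠ 0 := by positivity
    field_simp
  have hint : ∀ T : ℝ, 0 ≤ T → IntervalIntegrable (fun u : ℝ => A u.toNNReal) volume 0 T :=
    fun T hT => by
      obtain ⟨n, hn⟩ := (((tendsto_add_atTop_iff_nat 1).2 htop).eventually_ge_atTop T).exists
      exact hA.intervalIntegrable hT hn
  have hnn : ∀ u : ℝ, 0 ≤ A u.toNNReal := fun u => hA.nonneg htop _
  refine ⟨hint, ?_⟩
  have h := tendsto_div_of_tendsto_div_times
    (F := fun T => ∫ u in (0 : ℝ)..T, A u.toNNReal) (t := fun n => (x.time n : ℝ)) (a := a)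
    (fun S hS T hT hST => intervalIntegral.integral_mono_interval le_rfl hS hST
      (ae_of_all _ hnn) (hint T hT))
    (fun T hT => intervalIntegral.integral_nonneg hT fun u _ => hnn u) (by simp)
    (fun p q hpq => NNReal.coe_le_coe.2 (x.monotone_time hpq)) hc ht
    (ha.congr fun n => by rw [hA.integral_eq])
  exact h.congr fun T => by rw [one_div, inv_mul_eq_div]

end NetworkData

/-! ### Order statistics of exponential variables -/

lemma abs_one_sub_exp_pow_mul_le {r u : ℝ} (hr : 0 < r) (hu : 0 ≤ u) (i M : ℕ) :
    |(1 - Real.exp (-(r * u))) ^ i * Real.exp (-(r * u)) ^ M| ≤ Real.exp (-(r * M) * u) := by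
  have h1 : Real.exp (-(r * u)) ≤ 1 := Real.exp_le_one_iff.2 (by nlinarith)
  have h2 := Real.exp_pos (-(r * u))
  rw [abs_of_nonneg (mul_nonneg (pow_nonneg (by linarith) _) (pow_nonneg h2.le _))]
  calc (1 - Real.exp (-(r * u))) ^ i * Real.exp (-(r * u)) ^ M
      ≤ 1 * Real.exp (-(r * u)) ^ M := by
        gcongr
        exact pow_le_one₀ (by linarith) (by linarith)
    _ = Real.exp (-(r * M) * u) := by
        rw [one_mul, ← Real.exp_nat_mul]
        congr 1
        ring

lemma integrableOn_one_sub_exp_pow_mul {r : ℝ} (hr : 0 < r) (i : ℕ) {M : ℕ} (hM : 0 < M) :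
    IntegrableOn (fun u => (1 - Real.exp (-(r * u))) ^ i * Real.exp (-(r * u)) ^ M)
      (Set.Ioi 0) := by
  have hb : 0 < r * M := by positivity
  refine Integrable.mono' (exp_neg_integrableOn_Ioi 0 hb) ?_ ?_
  · exact (by fun_prop : Continuous fun u =>
      (1 - Real.exp (-(r * u))) ^ i * Real.exp (-(r * u)) ^ M).aestronglyMeasurable
  · filter_upwards [ae_restrict_mem measurableSet_Ioi] with u hu
    exact abs_one_sub_exp_pow_mul_le hr (le_of_lt hu) i M

/-- A Beta integral in the variable exp (-r u). Integration by parts lowers i by one and raises M by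
one, hence the induction over i for all M. -/
lemma integral_one_sub_exp_pow_mul {r : ℝ} (hr : 0 < r) (i : ℕ) {M : ℕ} (hM : 0 < M) :
    ∫ u in Set.Ioi (0 : ℝ), (1 - Real.exp (-(r * u))) ^ i * Real.exp (-(r * u)) ^ M
      = 1 / (r * M * (i + M).choose i) := by
  induction i generalizing M with
  | zero =>
    have h : ∀ u : ℝ, (1 - Real.exp (-(r * u))) ^ 0 * Real.exp (-(r * u)) ^ M
        = Real.exp (-(r * M) * u) := fun u => by
      rw [pow_zero, one_mul, ← Real.exp_nat_mul]
      congr 1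
      ring
    have hb : -(r * M) < 0 := by
      have : 0 < r * M := by positivity
      linarith
    simp_rw [h]
    rw [integral_exp_mul_Ioi hb]
    simp
  | succ i ih =>
    let g : ℝ → ℝ := fun u => (1 - Real.exp (-(r * u))) ^ (i + 1) * Real.exp (-(r * u)) ^ M
    let g' : ℝ → ℝ := fun u =>
      (r * (i + 1)) * ((1 - Real.exp (-(r * u))) ^ i * Real.exp (-(r * u)) ^ (M + 1)) -
      (r * M) * ((1 - Real.exp (-(r * u))) ^ (i + 1) * Real.exp (-(r * u)) ^ M)
    have hderiv : ∀ u ∈ Set.Ici (0 : ℝ), HasDerivAt g (g' u) u := fun u _ => by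
      have h1 : HasDerivAt (fun u : ℝ => Real.exp (-(r * u))) (Real.exp (-(r * u)) * (-r)) u := by
        have := ((hasDerivAt_id u).const_mul r).neg.exp
        simpa using this
      have h2 : HasDerivAt g _ u := ((h1.const_sub 1).pow (i + 1)).mul (h1.pow M)
      refine h2.congr_deriv ?_
      obtain ⟨M, rfl⟩ := Nat.exists_eq_succ_of_ne_zero hM.ne'
      simp only [g', Nat.add_sub_cancel, Nat.succ_eq_add_one, Pi.pow_apply]
      push_cast
      ring
    have hi1 := (integrableOn_one_sub_exp_pow_mul hr i (Nat.succ_pos M)).const_mul (r * (i + 1))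
    have hi2 := (integrableOn_one_sub_exp_pow_mul hr (i + 1) hM).const_mul (r * M)
    have hlim : Tendsto g atTop (𝓝 0) := by
      have hb : 0 < r * M := by positivity
      have h0 : Tendsto (fun u : ℝ => Real.exp (-(r * M) * u)) atTop (𝓝 0) :=
        Real.tendsto_exp_atBot.comp (tendsto_id.const_mul_atTop_of_neg (by linarith))
      refine squeeze_zero_norm' ?_ h0
      filter_upwards [eventually_ge_atTop 0] with u hu
      exact abs_one_sub_exp_pow_mul_le hr hu (i + 1) M
    -- `g` vanishes at 0, because of the exponent i + 1, and at infinity, because M > 0. So `g'`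
    -- integrates to 0, which relates (i + 1, M) to (i, M + 1).
    have h := integral_Ioi_of_hasDerivAt_of_tendsto' hderiv (hi1.sub hi2) hlim
    have h3 : ∫ u in Set.Ioi (0 : ℝ), g' u = (r * (i + 1)) * (1 / (r * (M + 1 : ℕ) *
        (i + (M + 1)).choose i)) - (r * M) * ∫ u in Set.Ioi (0 : ℝ),
          (1 - Real.exp (-(r * u))) ^ (i + 1) * Real.exp (-(r * u)) ^ M := by
      rw [← ih (Nat.succ_pos M), ← integral_const_mul, ← integral_const_mul]
      exact integral_sub hi1 hi2
    have hg0 : g 0 = 0 := by simp [g]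
    rw [h3, hg0, sub_zero] at h
    have hc := Nat.choose_succ_right_eq (i + (M + 1)) i
    rw [show i + (M + 1) - i = M + 1 by omega] at hc
    have hcR : ((i + (M + 1)).choose (i + 1) : ℝ) * (i + 1)
        = (i + (M + 1)).choose i * ((M + 1 : ℕ) : ℝ) := by exact_mod_cast hc
    have hp1 : (0 : ℝ) < (i + (M + 1)).choose i := by
      exact_mod_cast Nat.choose_pos (by omega)
    have hp2 : (0 : ℝ) < (i + (M + 1)).choose (i + 1) := by
      exact_mod_cast Nat.choose_pos (by omega)
    have hrM : 0 < r * M := by positivity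
    rw [show i + 1 + M = i + (M + 1) by omega]
    have h4 := sub_eq_zero.1 h
    rw [eq_div_iff (by positivity)]
    have h5 : (∫ u in Set.Ioi (0 : ℝ), (1 - Real.exp (-(r * u))) ^ (i + 1) *
        Real.exp (-(r * u)) ^ M) * (r * M) = (i + 1) / ((M + 1 : ℕ) * (i + (M + 1)).choose i) := by
      rw [mul_comm, ← h4]
      field_simp
    rw [← mul_assoc, h5, div_mul_eq_mul_div, div_eq_one_iff_eq (by positivity)]
    linarith

/-- The members of `I` which have been activated by time `u`. -/
def activated {ι : Type*} (I : Finset ι) (N : ι → CountingPath) (u : ℝ≥0) : Finset ι :=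
  I.filter fun e => N e u ≠ 0

section

variable {ι : Type*} {ν : Measure CountingPath} [IsProbabilityMeasure ν] {r : ℝ≥0}

lemma setOf_card_activated_lt [DecidableEq ι] (I : Finset ι) (q : ℕ) :
    {p : (ι → CountingPath) × ℝ | (activated I p.1 p.2.toNNReal).card < q} =
      ⋃ A ∈ I.powerset.filter fun A => A.card < q,
        {p | activated I p.1 p.2.toNNReal = A} := by
  ext p
  simp only [Set.mem_ofPred_eq, Set.mem_iUnion, Finset.mem_filter, Finset.mem_powerset,
    exists_prop, exists_eq_right']
  exact ⟨fun h => ⟨Finset.filter_subset _ _, h⟩, fun h => h.2⟩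

variable [Fintype ι]

lemma measurableSet_activated_eq [DecidableEq ι] (I A : Finset ι) :
    MeasurableSet {p : (ι → CountingPath) × ℝ | activated I p.1 p.2.toNNReal = A} := by
  have h : {p : (ι → CountingPath) × ℝ | activated I p.1 p.2.toNNReal = A} =
      ⋂ e, {p | e ∈ activated I p.1 p.2.toNNReal ↔ e ∈ A} := by
    ext p
    simp [Finset.ext_iff]
  rw [h]
  refine MeasurableSet.iInter fun e => ?_
  have he : MeasurableSet {p : (ι → CountingPath) × ℝ | p.1 e p.2.toNNReal = 0} :=
    (((measurable_pi_apply e).comp measurable_fst).countingPath_eval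
      (measurable_real_toNNReal.comp measurable_snd)) (measurableSet_singleton 0)
  by_cases hI : e ∈ I <;> by_cases hA : e ∈ A
  · simp only [activated, Finset.mem_filter, hI, hA, true_and, iff_true]
    exact he.compl
  · simp only [activated, Finset.mem_filter, hI, hA, true_and, iff_false, not_not]
    exact he
  · simp [activated, hI, hA]
  · simp [activated, hI, hA]

/-- The event is a box: edges in A have been activated, those in I \ A have not, and the others are
unconstrained. -/
lemma pi_activated_eq [DecidableEq ι]
    (hν : IsPoissonCounter (fun t (x : CountingPath) => x t) r ν) {I A : Finset ι} (hA : A ⊆ I)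
    (u : ℝ≥0) :
    Measure.pi (fun _ : ι => ν) {N | activated I N u = A} = ENNReal.ofReal
      ((1 - Real.exp (-(r * u))) ^ A.card * Real.exp (-(r * u)) ^ (I.card - A.card)) := by
  let s : ι → Set CountingPath := fun e =>
    if e ∈ I then (if e ∈ A then {x | x u ≠ 0} else {x | x u = 0}) else Set.univ
  have h1 : {N : ι → CountingPath | activated I N u = A} = Set.univ.pi s := by
    ext N
    simp only [Set.mem_ofPred_eq, Finset.ext_iff, activated, Finset.mem_filter, Set.mem_pi,
      Set.mem_univ, true_imp_iff]
    refine forall_congr' fun e => ?_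
    by_cases hI : e ∈ I
    · by_cases hA' : e ∈ A <;> simp [s, hI, hA']
    · simpa [s, hI] using fun h => hI (hA h)
  have hle : Real.exp (-(r * u : ℝ)) ≤ 1 := Real.exp_le_one_iff.2 (by
    have := mul_nonneg r.coe_nonneg u.coe_nonneg
    linarith)
  have h0 : ν {x | x u = 0} = ENNReal.ofReal (Real.exp (-(r * u))) := hν.measure_eq_zero u
  have h2 : ν {x | x u ≠ 0} = ENNReal.ofReal (1 - Real.exp (-(r * u))) := by
    have := prob_compl_eq_one_sub (μ := ν)
      ((CountingPath.measurable_apply u) (measurableSet_singleton 0))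
    rw [ENNReal.ofReal_sub _ (Real.exp_nonneg _), ENNReal.ofReal_one, ← h0]
    exact this
  have h3 : ∀ e, ν (s e) = if e ∈ I then (if e ∈ A then ENNReal.ofReal (1 - Real.exp (-(r * u)))
      else ENNReal.ofReal (Real.exp (-(r * u)))) else 1 := fun e => by
    simp only [s]
    split_ifs <;> simp [h0, h2]
  rw [h1, Measure.pi_pi, Finset.prod_congr rfl fun e _ => h3 e, Finset.prod_ite_mem,
    Finset.univ_inter, Finset.prod_ite, Finset.prod_const, Finset.prod_const,
    Finset.filter_mem_eq_inter, Finset.inter_eq_right.2 hA, Finset.filter_notMem_eq_sdiff,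
    Finset.card_sdiff_of_subset hA, ENNReal.ofReal_mul (pow_nonneg (by linarith) _),
    ENNReal.ofReal_pow (by linarith), ENNReal.ofReal_pow (Real.exp_nonneg _)]

/-- The time during which fewer than `q` members of `I` have been activated. -/
noncomputable def activationTime (I : Finset ι) (q : ℕ) (N : ι → CountingPath) : ℝ≥0∞ :=
  volume.restrict (Set.Ici (0 : ℝ)) {u | (activated I N u.toNNReal).card < q}

lemma measurableSet_card_activated_lt [DecidableEq ι] (I : Finset ι) (q : ℕ) :
    MeasurableSet {p : (ι → CountingPath) × ℝ | (activated I p.1 p.2.toNNReal).card < q} := by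
  rw [setOf_card_activated_lt]
  exact Finset.measurableSet_biUnion _ fun A _ => measurableSet_activated_eq I A

lemma measurable_activationTime (I : Finset ι) (q : ℕ) : Measurable (activationTime I q) := by
  classical
  exact measurable_measure_prodMk_left (measurableSet_card_activated_lt I q)

/-- The expectation of the `q`-th order statistic of independent exponential variables. -/
theorem lintegral_activationTime (hr : 0 < r)
    (hν : IsPoissonCounter (fun t (x : CountingPath) => x t) r ν) (I : Finset ι) {q : ℕ}
    (hq : q ≤ I.card) :
    ∫⁻ N, activationTime I q N ∂(Measure.pi fun _ => ν) = ENNReal.ofReal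
      (1 / (r : ℝ) * ∑ i ∈ Finset.Icc (I.card + 1 - q) I.card, 1 / (i : ℝ)) := by
  classical
  have hS := measurableSet_card_activated_lt I q
  have h := Measure.prod_apply (μ := Measure.pi fun _ : ι => ν)
    (ν := volume.restrict (Set.Ici (0 : ℝ))) hS
  rw [Measure.prod_apply_symm hS] at h
  have hr' : (0 : ℝ) < r := hr
  let f : ℕ → ℝ → ℝ := fun i u =>
    (1 - Real.exp (-(r * u))) ^ i * Real.exp (-(r * u)) ^ (I.card - i)
  have h1 : ∀ u ∈ Set.Ici (0 : ℝ), Measure.pi (fun _ : ι => ν)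
      ((fun N => (N, u)) ⁻¹' {p : (ι → CountingPath) × ℝ |
        (activated I p.1 p.2.toNNReal).card < q})
      = ∑ A ∈ I.powerset.filter fun A => A.card < q, ENNReal.ofReal (f A.card u) := fun u hu => by
    rw [setOf_card_activated_lt, Set.preimage_iUnion₂, measure_biUnion_finset]
    · refine Finset.sum_congr rfl fun A hA => ?_
      have h2 := pi_activated_eq hν (Finset.mem_powerset.1 (Finset.mem_filter.1 hA).1) u.toNNReal
      rw [Real.coe_toNNReal u hu] at h2
      exact h2
    · intro A _ B _ hAB
      refine Set.disjoint_left.2 fun N hNA hNB => hAB ?_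
      exact (Eq.symm hNA).trans hNB
    · exact fun A _ => measurable_prodMk_right (measurableSet_activated_eq I A)
  have hint : ∀ i < q, ∫⁻ u in Set.Ici (0 : ℝ), ENNReal.ofReal (f i u)
      = ENNReal.ofReal (1 / (r * (I.card - i : ℕ) * I.card.choose i)) := fun i hi => by
    have hM : 0 < I.card - i := by omega
    rw [setLIntegral_congr Ioi_ae_eq_Ici.symm]
    have h3 := integral_one_sub_exp_pow_mul hr' i hM
    rw [show i + (I.card - i) = I.card by omega] at h3
    rw [← h3, ofReal_integral_eq_lintegral_ofReal (integrableOn_one_sub_exp_pow_mul hr' i hM)]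
    filter_upwards [ae_restrict_mem measurableSet_Ioi] with u hu
    have : Real.exp (-(r * u)) ≤ 1 := Real.exp_le_one_iff.2 (by
      have := mul_pos hr' hu
      linarith)
    exact mul_nonneg (pow_nonneg (by linarith) _) (pow_nonneg (Real.exp_nonneg _) _)
  have hf : ∀ i, Measurable fun u => ENNReal.ofReal (f i u) := fun i => by
    simp only [f]
    fun_prop
  have h4 : ∫⁻ N, activationTime I q N ∂(Measure.pi fun _ => ν)
      = ∑ A ∈ I.powerset.filter fun A => A.card < q,
          ENNReal.ofReal (1 / (r * (I.card - A.card : ℕ) * I.card.choose A.card)) := by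
    refine h.symm.trans ?_
    rw [setLIntegral_congr_fun measurableSet_Ici h1, lintegral_finsetSum _ fun A _ => hf A.card]
    exact Finset.sum_congr rfl fun A hA => hint _ (Finset.mem_filter.1 hA).2
  rw [h4, ← ENNReal.ofReal_sum_of_nonneg fun A _ => by positivity]
  congr 1
  -- The number of subsets of size i cancels the binomial coefficient of the Beta integral, leaving
  -- 1 / (r (|I| - i)) for i < q; the substitution of |I| - i for i gives the harmonic sum.
  rw [Finset.sum_filter, Finset.sum_powerset_apply_card (fun i =>
    if i < q then (1 : ℝ) / (r * (I.card - i : ℕ) * I.card.choose i) else 0), Finset.mul_sum]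
  simp_rw [smul_ite, smul_zero]
  rw [← Finset.sum_filter]
  refine Finset.sum_nbij' (fun i => I.card - i) (fun i => I.card - i) ?_ ?_ ?_ ?_ ?_
  · intro i hi
    simp only [Finset.mem_filter, Finset.mem_range, Finset.mem_Icc] at hi ⊢
    omega
  · intro i hi
    simp only [Finset.mem_filter, Finset.mem_range, Finset.mem_Icc] at hi ⊢
    omega
  · intro i hi
    simp only [Finset.mem_filter, Finset.mem_range] at hi
    omega
  · intro i hi
    simp only [Finset.mem_Icc] at hi
    omega
  · intro i hi
    simp only [Finset.mem_filter, Finset.mem_range] at hi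
    have h5 : (0 : ℝ) < I.card.choose i := by exact_mod_cast Nat.choose_pos (by omega)
    have h6 : (0 : ℝ) < (I.card - i : ℕ) := by exact_mod_cast (by omega : 0 < I.card - i)
    rw [nsmul_eq_mul]
    field_simp

end

/-! ### Comparison of the decryption delay with order statistics -/

/-- The edges from the members of `K` to `j`. -/
def edgesTo {m : ℕ} (j : Fin m) (K : Finset (Fin m)) : Finset (GossipEdge m) :=
  Finset.univ.filter fun e => e.1.2 = j ∧ e.1.1 ∈ K

lemma mem_edgesTo {m : ℕ} {j : Fin m} {K : Finset (Fin m)} {e : GossipEdge m} :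
    e ∈ edgesTo j K ↔ e.1.2 = j ∧ e.1.1 ∈ K := by
  simp [edgesTo]

lemma injOn_source_edgesTo {m : ℕ} (j : Fin m) (K : Finset (Fin m)) :
    Set.InjOn (fun e : GossipEdge m => e.1.1) (edgesTo j K) := fun _ he _ he' h =>
  Subtype.ext (Prod.ext h ((mem_edgesTo.1 he).1.trans (mem_edgesTo.1 he').1.symm))

lemma card_edgesTo {m : ℕ} (j : Fin m) (K : Finset (Fin m)) :
    (edgesTo j K).card = (K.erase j).card := by
  rw [← Finset.card_image_of_injOn (injOn_source_edgesTo j K)]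
  congr 1
  ext i
  simp only [Finset.mem_image, mem_edgesTo, Finset.mem_erase]
  constructor
  · rintro ⟨e, ⟨h1, h2⟩, rfl⟩
    exact ⟨fun h => e.2 (h.trans h1.symm), h2⟩
  · rintro ⟨h1, h2⟩
    exact ⟨⟨(i, j), h1⟩, ⟨rfl, h2⟩, rfl⟩

namespace NetworkData

variable {m : ℕ}

/-- A key other than the own key of j arrives by an activation after the update, hence after time 0.
The bound is uniform in l, so that it applies to all versions at once. -/
lemma card_heldKeys_le (j : Fin m) (x : NetworkData m) (l : ℕ) (u : ℝ≥0) :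
    (heldKeys j x l u).card ≤ (activated (edgesTo j Finset.univ) x.2.2 u).card + 1 := by
  classical
  have hsub : heldKeys j x l u ⊆
      insert j ((activated (edgesTo j Finset.univ) x.2.2 u).image fun e => e.1.1) := fun i hi => by
    obtain ⟨-, rfl | ⟨hij, h⟩⟩ := mem_heldKeys.1 hi
    · exact Finset.mem_insert_self _ _
    · refine Finset.mem_insert_of_mem (Finset.mem_image.2 ⟨⟨(i, j), hij⟩, ?_, rfl⟩)
      exact Finset.mem_filter.2 ⟨mem_edgesTo.2 ⟨rfl, Finset.mem_univ _⟩, Nat.ne_zero_of_lt h⟩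
  exact (Finset.card_le_card hsub).trans
    ((Finset.card_insert_le _ _).trans (Nat.add_le_add_right Finset.card_image_le 1))

/-- As version 0 is sent at time 0, any activated edge from a key holder has delivered its key; the
own key of j comes on top. -/
lemma card_activated_le (j : Fin m) (x : NetworkData m) (u : ℝ≥0) :
    (activated (edgesTo j (x.2.1 0)) x.2.2 u).card + (if j ∈ x.2.1 0 then 1 else 0)
      ≤ (heldKeys j x 0 u).card := by
  classical
  have hinj : Set.InjOn (fun e : GossipEdge m => e.1.1)
      (activated (edgesTo j (x.2.1 0)) x.2.2 u) :=
    (injOn_source_edgesTo j (x.2.1 0)).mono (Finset.coe_subset.2 (Finset.filter_subset _ _))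
  have hmem : (activated (edgesTo j (x.2.1 0)) x.2.2 u).image (fun e => e.1.1)
      ⊆ (heldKeys j x 0 u).erase j := fun i hi => by
    obtain ⟨e, he, rfl⟩ := Finset.mem_image.1 hi
    obtain ⟨he1, he2⟩ := Finset.mem_filter.1 he
    obtain ⟨rfl, h2⟩ := mem_edgesTo.1 he1
    refine Finset.mem_erase.2 ⟨e.2, mem_heldKeys.2 ⟨h2, Or.inr ⟨e.2, ?_⟩⟩⟩
    rw [time_zero, CountingPath.map_zero]
    exact Nat.pos_of_ne_zero he2
  have hcard := Finset.card_le_card hmem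
  rw [Finset.card_image_of_injOn hinj] at hcard
  split_ifs with hj
  · have hj' : j ∈ heldKeys j x 0 u := mem_heldKeys.2 ⟨hj, Or.inl rfl⟩
    rw [Finset.card_erase_of_mem hj'] at hcard
    have := Finset.card_pos.2 ⟨j, hj'⟩
    omega
  · exact hcard.trans (Finset.card_le_card (Finset.erase_subset _ _))

variable {ρ : Measure ℝ≥0} {κ : Measure (Finset (Fin m))} {ν : Measure CountingPath}
  [IsProbabilityMeasure ρ] [IsProbabilityMeasure κ] [IsProbabilityMeasure ν] {r : ℝ≥0}

lemma measurePreserving_paths :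
    MeasurePreserving (fun x : NetworkData m => x.2.2) (law ρ κ ν) (Measure.pi fun _ => ν) :=
  measurePreserving_snd.comp measurePreserving_snd

lemma measurePreserving_holders_paths :
    MeasurePreserving (fun x : NetworkData m => (x.2.1 0, x.2.2)) (law ρ κ ν)
      (κ.prod (Measure.pi fun _ => ν)) :=
  ((measurePreserving_eval_infinitePi (fun _ => κ) 0).prod (MeasurePreserving.id _)).comp
    measurePreserving_snd

/-- The decryption delay is at least the one in the network in which all nodes receive keys from
the source. -/
theorem le_lintegral_delay (hr : 0 < r)
    (hν : IsPoissonCounter (fun t (x : CountingPath) => x t) r ν) {k : ℕ} (hk : k < m) (j : Fin m) :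
    ENNReal.ofReal (1 / (r : ℝ) * ∑ i ∈ Finset.Icc (m - k) (m - 1), 1 / (i : ℝ))
      ≤ ∫⁻ x, delay k j x ∂(law ρ κ ν) := by
  have hcard : (edgesTo j Finset.univ).card = m - 1 := by
    rw [card_edgesTo, Finset.card_erase_of_mem (Finset.mem_univ _), Finset.card_univ,
      Fintype.card_fin]
  -- k activations rather than k + 1, since the own key of j may count.
  have h := lintegral_activationTime hr hν (edgesTo j Finset.univ) (q := k) (by omega)
  rw [hcard, show m - 1 + 1 - k = m - k by omega] at h
  rw [← h, ← (measurePreserving_paths (ρ := ρ) (κ := κ) (ν := ν)).lintegral_comp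
    (measurable_activationTime _ _)]
  refine lintegral_mono fun x => measure_mono fun u hu l _ => ?_
  have h1 := card_heldKeys_le j x l u.toNNReal
  have h2 : (activated (edgesTo j Finset.univ) x.2.2 u.toNNReal).card < k := hu
  omega

/-- The decryption delay is at most the one of a single version. -/
theorem lintegral_delay_le (hr : 0 < r)
    (hν : IsPoissonCounter (fun t (x : CountingPath) => x t) r ν) {k n : ℕ} (hkn : k < n)
    (hκ : ∀ᵐ K ∂κ, K.card = n) (j : Fin m) :
    ∫⁻ x, delay k j x ∂(law ρ κ ν)
      ≤ ENNReal.ofReal (1 / (r : ℝ) * ∑ i ∈ Finset.Icc (n - k) n, 1 / (i : ℝ)) := by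
  -- The number of keys to be received from others. With n - 1 or n incoming edges respectively, the
  -- harmonic sum starts at n - k in both cases.
  let q : Finset (Fin m) → ℕ := fun K => if j ∈ K then k else k + 1
  let f : Finset (Fin m) × (GossipEdge m → CountingPath) → ℝ≥0∞ := fun p =>
    activationTime (edgesTo j p.1) (q p.1) p.2
  have hf : Measurable f := measurable_from_prod_countable_right fun K =>
    measurable_activationTime (edgesTo j K) (q K)
  have h1 : ∫⁻ x, delay k j x ∂(law ρ κ ν) ≤ ∫⁻ x, f (x.2.1 0, x.2.2) ∂(law ρ κ ν) := by
    refine lintegral_mono fun x => measure_mono fun u hu => ?_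
    have h2 := (card_activated_le j x u.toNNReal).trans (hu 0 zero_le)
    change (activated (edgesTo j (x.2.1 0)) x.2.2 u.toNNReal).card < q (x.2.1 0)
    simp only [q]
    split_ifs at h2 ⊢ <;> omega
  refine h1.trans ?_
  rw [measurePreserving_holders_paths.lintegral_comp hf, lintegral_prod _ hf.aemeasurable]
  have h3 : ∀ᵐ K ∂κ, ∫⁻ N, f (K, N) ∂(Measure.pi fun _ => ν)
      ≤ ENNReal.ofReal (1 / (r : ℝ) * ∑ i ∈ Finset.Icc (n - k) n, 1 / (i : ℝ)) := by
    filter_upwards [hκ] with K hK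
    by_cases hj : j ∈ K
    · have hc : (edgesTo j K).card = n - 1 := by
        rw [card_edgesTo, Finset.card_erase_of_mem hj, hK]
      simp only [f, q, if_pos hj]
      rw [lintegral_activationTime hr hν _ (by omega), hc, show n - 1 + 1 - k = n - k by omega]
      refine ENNReal.ofReal_le_ofReal (mul_le_mul_of_nonneg_left ?_ (by positivity))
      -- If j holds its own key the sum ends at n - 1; the term 1 / n is added for a bound common to
      -- both cases.
      exact Finset.sum_le_sum_of_subset_of_nonneg
        (Finset.Icc_subset_Icc_right (Nat.sub_le n 1)) fun i _ _ => by positivity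
    · have hc : (edgesTo j K).card = n := by
        rw [card_edgesTo, Finset.erase_eq_of_notMem hj, hK]
      simp only [f, q, if_neg hj]
      rw [lintegral_activationTime hr hν _ (by omega), hc, show n + 1 - (k + 1) = n - k by omega]
  refine (lintegral_mono_ae h3).trans ?_
  rw [lintegral_const, measure_univ, mul_one]

/-! ### Symmetry -/

/-- The permutation of the edges induced by a permutation of the nodes. -/
def _root_.edgePerm (σ : Equiv.Perm (Fin m)) : Equiv.Perm (GossipEdge m) where
  toFun e := ⟨(σ e.1.1, σ e.1.2), fun h => e.2 (σ.injective h)⟩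
  invFun e := ⟨(σ.symm e.1.1, σ.symm e.1.2), fun h => e.2 (σ.symm.injective h)⟩
  left_inv e := by simp
  right_inv e := by simp

/-- The network with relabelled nodes: the node `i` of the relabelled network is the node `σ i`. -/
def relabel (σ : Equiv.Perm (Fin m)) (x : NetworkData m) : NetworkData m :=
  (x.1, fun l => (x.2.1 l).map σ.symm.toEmbedding, fun e => x.2.2 (edgePerm σ e))

lemma heldKeys_relabel (σ : Equiv.Perm (Fin m)) (j : Fin m) (x : NetworkData m) (l : ℕ) (u : ℝ≥0) :
    heldKeys j (relabel σ x) l u = (heldKeys (σ j) x l u).map σ.symm.toEmbedding := by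
  ext i
  rw [Finset.mem_map_equiv, mem_heldKeys, mem_heldKeys]
  refine and_congr ?_ (or_congr ?_ ?_)
  · exact Finset.mem_map_equiv
  · simp
  · constructor
    · rintro ⟨h, h'⟩
      exact ⟨fun h2 => h (σ.injective h2), h'⟩
    · rintro ⟨h, h'⟩
      exact ⟨fun h2 => h (congrArg σ h2), h'⟩

lemma delay_relabel (k : ℕ) (σ : Equiv.Perm (Fin m)) (j : Fin m) (x : NetworkData m) :
    delay k j (relabel σ x) = delay k (σ j) x := by
  have h : ∀ u, Undecrypted k j (relabel σ x) u ↔ Undecrypted k (σ j) x u := fun u => by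
    refine forall_congr' fun l => ?_
    rw [heldKeys_relabel, Finset.card_map]
    rfl
  simp only [delay, h]

lemma measurePreserving_pi_comp_perm {ι : Type*} [Fintype ι] (τ : Equiv.Perm ι) :
    MeasurePreserving (fun (N : ι → CountingPath) e => N (τ e))
      (Measure.pi fun _ => ν) (Measure.pi fun _ => ν) := by
  have hm : Measurable fun (N : ι → CountingPath) e => N (τ e) :=
    measurable_pi_lambda _ fun e => measurable_pi_apply (τ e)
  refine ⟨hm, (Measure.pi_eq fun s hs => ?_).symm⟩
  rw [Measure.map_apply hm (MeasurableSet.univ_pi hs)]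
  have h : (fun (N : ι → CountingPath) e => N (τ e)) ⁻¹' Set.univ.pi s
      = Set.univ.pi fun e => s (τ.symm e) := by
    ext N
    simp only [Set.mem_preimage, Set.mem_pi, Set.mem_univ, true_imp_iff]
    exact ⟨fun h e => by simpa using h (τ.symm e), fun h e => by simpa using h (τ e)⟩
  rw [h, Measure.pi_pi]
  exact Equiv.prod_comp τ.symm fun e => ν (s e)

/-- Nodes which are exchangeable for the source have the same mean decryption delay. -/
theorem lintegral_delay_eq (k : ℕ) (σ : Equiv.Perm (Fin m))
    (hσ : κ.map (fun K => K.map σ.symm.toEmbedding) = κ) (j : Fin m) :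
    ∫⁻ x, delay k (σ j) x ∂(law ρ κ ν) = ∫⁻ x, delay k j x ∂(law ρ κ ν) := by
  have h1 : MeasurePreserving
      (fun (K : ℕ → Finset (Fin m)) l => (K l).map σ.symm.toEmbedding)
      (Measure.infinitePi fun _ => κ) (Measure.infinitePi fun _ => κ) := by
    have hm : Measurable fun K : Finset (Fin m) => K.map σ.symm.toEmbedding :=
      measurable_of_countable _
    refine ⟨measurable_pi_lambda _ fun l => hm.comp (measurable_pi_apply l), ?_⟩
    rw [Measure.infinitePi_map_pi _ fun _ => hm, hσ]
  have h2 : MeasurePreserving (relabel σ) (law ρ κ ν) (law ρ κ ν) :=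
    (MeasurePreserving.id _).prod (h1.prod (measurePreserving_pi_comp_perm (edgePerm σ)))
  rw [← h2.lintegral_comp (measurable_delay k j)]
  simp_rw [delay_relabel]

end NetworkData

/-! ### The laws of the cycle lengths and of the key holders -/

lemma expMeasure_Ioi {lam : ℝ} (h : 0 < lam) {t : ℝ} (ht : 0 ≤ t) :
    expMeasure lam (Set.Ioi t) = ENNReal.ofReal (Real.exp (-lam * t)) := by
  have := isProbabilityMeasure_expMeasure h
  rw [← Set.compl_Iic, prob_compl_eq_one_sub measurableSet_Iic, ← ofReal_cdf,
    cdf_expMeasure_eq h, if_pos ht, ← ENNReal.ofReal_one, ← ENNReal.ofReal_sub]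
  · congr 1
    ring_nf
  · rw [sub_nonneg, Real.exp_le_one_iff]
    have := mul_nonneg h.le ht
    linarith

lemma ae_pos_expMeasure {lam : ℝ} (h : 0 < lam) : ∀ᵐ c ∂expMeasure lam, 0 < c := by
  have := isProbabilityMeasure_expMeasure h
  have h1 : expMeasure lam (Set.Ioi 0) = 1 := by simp [expMeasure_Ioi h le_rfl]
  exact mem_ae_iff_prob_eq_one measurableSet_Ioi |>.2 h1

/-- The layer cake formula: the mean is the integral of the tail exp (-lam t). -/
lemma lintegral_ofReal_expMeasure {lam : ℝ} (h : 0 < lam) :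
    ∫⁻ c, ENNReal.ofReal c ∂expMeasure lam = ENNReal.ofReal (1 / lam) := by
  have h1 : ∫⁻ t in Set.Ioi (0 : ℝ), expMeasure lam {c | t < c}
      = ∫⁻ t in Set.Ioi (0 : ℝ), ENNReal.ofReal (Real.exp (-lam * t)) :=
    setLIntegral_congr_fun measurableSet_Ioi fun t ht => expMeasure_Ioi h (le_of_lt ht)
  rw [lintegral_eq_lintegral_meas_lt _ ((ae_pos_expMeasure h).mono fun c hc => hc.le)
    aemeasurable_id, h1, ← ofReal_integral_eq_lintegral_ofReal
      (integrableOn_exp_mul_Ioi (neg_lt_zero.2 h) 0) (ae_of_all _ fun t => (Real.exp_pos _).le),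
    integral_exp_mul_Ioi (neg_lt_zero.2 h)]
  simp [neg_div_neg_eq]

lemma integrable_id_expMeasure {lam : ℝ} (h : 0 < lam) :
    Integrable (fun c : ℝ => c) (expMeasure lam) := by
  refine ⟨aestronglyMeasurable_id, ?_⟩
  rw [hasFiniteIntegral_iff_ofReal ((ae_pos_expMeasure h).mono fun c hc => hc.le),
    lintegral_ofReal_expMeasure h]
  exact ENNReal.ofReal_lt_top

lemma integral_id_expMeasure {lam : ℝ} (h : 0 < lam) : ∫ c, c ∂expMeasure lam = 1 / lam := by
  rw [integral_eq_lintegral_of_nonneg_ae ((ae_pos_expMeasure h).mono fun c hc => hc.le)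
    aestronglyMeasurable_id, lintegral_ofReal_expMeasure h, ENNReal.toReal_ofReal (by positivity)]

lemma map_uniformOn {α : Type*} [MeasurableSpace α] [MeasurableSingletonClass α] [Countable α]
    (e : Equiv.Perm α) {s : Set α} (hs : e ⁻¹' s = s) : (uniformOn s).map e = uniformOn s := by
  ext t ht
  rw [Measure.map_apply (measurable_of_countable e) ht, uniformOn,
    cond_apply s.to_countable.measurableSet, cond_apply s.to_countable.measurableSet]
  congr 1
  conv_lhs => rw [← hs]
  rw [← Set.preimage_inter, ← Equiv.image_symm_eq_preimage]
  exact Measure.count_injective_image e.symm.injective _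

/-- The possible sets of selected nonsubscribers. -/
abbrev selections {m : ℕ} (n : ℕ) (S : Finset (Fin m)) : Set (Finset (Fin m)) :=
  {A | A ⊆ Sᶜ ∧ A.card = n - S.card}

/-- The law of the set of nodes which receive a key of a given version from the source. -/
noncomputable def keyHoldersLaw {m : ℕ} (n : ℕ) (S : Finset (Fin m)) : Measure (Finset (Fin m)) :=
  (uniformOn (selections n S)).map (S ∪ ·)

lemma isProbabilityMeasure_keyHoldersLaw {m n : ℕ} {S : Finset (Fin m)} (hn : n ≤ m) :
    IsProbabilityMeasure (keyHoldersLaw n S) := by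
  have : IsProbabilityMeasure (uniformOn (selections n S)) := by
    refine isProbabilityMeasure_uniformOn (Set.toFinite _) ?_
    obtain ⟨A, hA⟩ := Finset.exists_subset_card_eq (s := Sᶜ) (n := n - S.card)
      (by rw [Finset.card_compl, Fintype.card_fin]; omega)
    exact ⟨A, hA⟩
  exact Measure.isProbabilityMeasure_map (measurable_of_countable _).aemeasurable

lemma ae_card_keyHoldersLaw {m n : ℕ} {S : Finset (Fin m)} (hS : S.card ≤ n) :
    ∀ᵐ K ∂keyHoldersLaw n S, K.card = n := by
  rw [keyHoldersLaw, ae_map_iff (measurable_of_countable _).aemeasurable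
    (Set.to_countable _).measurableSet]
  have h : ∀ᵐ A ∂uniformOn (selections n S), A ∈ selections n S :=
    ae_cond_mem (Set.toFinite _).measurableSet
  filter_upwards [h] with A hA
  rw [Finset.card_union_of_disjoint (Finset.disjoint_left.2 fun i hi hi' =>
    Finset.mem_compl.1 (hA.1 hi') hi), hA.2]
  omega

/-- A permutation that maps S onto itself permutes the admissible selections, which are equally
likely, and commutes with adjoining S. -/
lemma map_keyHoldersLaw {m : ℕ} (n : ℕ) {S : Finset (Fin m)} (σ : Equiv.Perm (Fin m))
    (hσ : S.map σ.toEmbedding = S) :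
    (keyHoldersLaw n S).map (fun K => K.map σ.toEmbedding) = keyHoldersLaw n S := by
  have hU : (uniformOn (selections n S)).map σ.finsetCongr = uniformOn (selections n S) := by
    refine map_uniformOn _ ?_
    ext A
    have : A.map σ.toEmbedding ⊆ Sᶜ ↔ A ⊆ Sᶜ := by
      rw [Finset.subset_compl_iff_disjoint_right, Finset.subset_compl_iff_disjoint_right]
      conv_lhs => rw [← hσ]
      exact Finset.disjoint_map _
    simp [selections, this]
  unfold keyHoldersLaw
  conv_rhs => rw [← hU]
  rw [Measure.map_map (measurable_of_countable _) (measurable_of_countable _),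
    Measure.map_map (measurable_of_countable _) (measurable_of_countable _)]
  congr 1
  funext A
  simp [Finset.map_union, hσ]

/-! ### Ages and decryption delays -/

lemma NetworkData.heldKeys_shift {m : ℕ} (j : Fin m) (x : NetworkData m) (d l : ℕ) {t : ℝ≥0}
    (h : x.time d ≤ t) : heldKeys j (shift d x) l (t - x.time d) = heldKeys j x (d + l) t := by
  ext i
  simp only [mem_heldKeys]
  refine and_congr Iff.rfl (or_congr Iff.rfl (exists_congr fun hij => ?_))
  change x.2.2 _ (x.time d + (shift d x).time l) - x.2.2 _ (x.time d)
    < x.2.2 _ (x.time d + (t - x.time d)) - x.2.2 _ (x.time d) ↔ _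
  rw [time_shift, add_tsub_cancel_of_le h]
  -- The same count is subtracted on both sides; since it is at most either of them, truncated
  -- subtraction does no harm.
  have h1 := (x.2.2 ⟨(i, j), hij⟩).monotone (x.monotone_time (Nat.le_add_right d l))
  have h2 := (x.2.2 ⟨(i, j), hij⟩).monotone h
  omega

lemma NetworkData.undecrypted_shift {m : ℕ} (k : ℕ) (j : Fin m) (x : NetworkData m) (d : ℕ)
    {t : ℝ≥0} (h : x.time d ≤ t) : Undecrypted k j (shift d x) (t - x.time d) ↔
      ∀ l, d ≤ l → x.time l ≤ t → (heldKeys j x l t).card ≤ k := by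
  constructor
  · intro hu l hl ht
    obtain ⟨l, rfl⟩ := Nat.exists_eq_add_of_le hl
    rw [← heldKeys_shift j x d l h]
    refine hu l ?_
    rwa [le_tsub_iff_left h, time_shift]
  · intro hu l hl
    rw [heldKeys_shift j x d l h]
    refine hu _ (Nat.le_add_right _ _) ?_
    rwa [le_tsub_iff_left h, time_shift] at hl

namespace HomogeneousNetwork

variable {Ω : Type*} [MeasurableSpace Ω] {μ : Measure Ω} {m n : ℕ} {S : Finset (Fin m)}
  {lamS lamE : ℝ}

/-- The inputs of the network. -/
noncomputable def data (G : HomogeneousNetwork μ m n S lamS lamE) (ω : Ω) : NetworkData m :=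
  (fun l => (G.cycle l ω).toNNReal, fun l => G.keyHolders l ω,
    fun e => (G.poisson_activations e).path ω)

variable (G : HomogeneousNetwork μ m n S lamS lamE) {ω : Ω}

lemma coe_time_data (hω : ∀ l, 0 < G.cycle l ω) (l : ℕ) :
    ((G.data ω).time l : ℝ) = G.updateTime l ω := by
  simp only [NetworkData.time, updateTime, NNReal.coe_sum]
  exact Finset.sum_congr rfl fun i _ => Real.coe_toNNReal _ (hω i).le

lemma strictMono_time_data (hω : ∀ l, 0 < G.cycle l ω) : StrictMono (G.data ω).time := by
  refine strictMono_nat_of_lt_succ fun l => ?_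
  rw [NetworkData.time, NetworkData.time, Finset.sum_range_succ]
  exact lt_add_of_pos_right _ (Real.toNNReal_pos.2 (hω l))

lemma canDecrypt_iff (hω : ∀ l, 0 < G.cycle l ω) (k : ℕ) (j : Fin m) (l : ℕ) (t : ℝ≥0) :
    G.CanDecrypt k j l t ω ↔
      (G.data ω).time l ≤ t ∧ k < (NetworkData.heldKeys j (G.data ω) l t).card := by
  have h1 : G.updateTime l ω ≤ t ↔ (G.data ω).time l ≤ t := by
    rw [← G.coe_time_data hω, NNReal.coe_le_coe]
  have h2 : (G.updateTime l ω).toNNReal = (G.data ω).time l := by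
    rw [← G.coe_time_data hω, Real.toNNReal_coe]
  unfold CanDecrypt
  by_cases ht : (G.data ω).time l ≤ t
  · have : {i : Fin m | G.HoldsKey j i l t ω} = NetworkData.heldKeys j (G.data ω) l t := by
      ext i
      simp only [Set.mem_ofPred_eq, HoldsKey, h1, ht, true_and, h2, Finset.mem_coe,
        NetworkData.mem_heldKeys]
      rfl
    rw [this, Set.ncard_coe_finset]
    simp only [ht, true_and, Nat.succ_le_iff]
  · have : {i : Fin m | G.HoldsKey j i l t ω} = ∅ := by
      ext i
      simp [HoldsKey, h1, ht]
    rw [this]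
    simp [ht]

lemma sourceVersion_eq (hω : ∀ l, 0 < G.cycle l ω) {N : ℕ} {t : ℝ≥0}
    (h : ∀ l, (G.data ω).time l ≤ t ↔ l ≤ N) : G.sourceVersion t ω = N := by
  have : {l : ℕ | 1 ≤ l ∧ G.updateTime l ω ≤ t} = Finset.Icc 1 N := by
    ext l
    simp only [← G.coe_time_data hω, NNReal.coe_le_coe, h, Set.mem_ofPred_eq, Finset.coe_Icc,
      Set.mem_Icc]
  rw [sourceVersion, this, Set.ncard_coe_finset, Nat.card_Icc, Nat.add_sub_cancel]

/-- A version above the one of node j is exactly one from which on nothing can be decrypted. Those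
that have also been issued form an interval whose length is the age. -/
lemma isAge_versionAge (hω : ∀ l, 0 < G.cycle l ω) (k : ℕ) (j : Fin m) :
    NetworkData.IsAge k j (G.data ω) fun t => G.versionAge k j t ω := by
  classical
  intro n t ht
  have hmono := G.strictMono_time_data hω
  obtain ⟨N, hNn, hN⟩ : ∃ N ≤ n, ∀ l, (G.data ω).time l ≤ t ↔ l ≤ N := by
    refine ⟨Nat.findGreatest (fun l => (G.data ω).time l ≤ t) n, Nat.findGreatest_le n,
      fun l => ⟨fun hl => ?_, fun hl => ?_⟩⟩
    · refine Nat.le_findGreatest ?_ hl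
      exact Nat.lt_succ_iff.1 (hmono.lt_iff_lt.1 (hl.trans_lt ht))
    · refine (hmono.monotone hl).trans ?_
      exact Nat.findGreatest_spec (P := fun l => (G.data ω).time l ≤ t) (Nat.zero_le n) (by simp)
  have hB : ∀ l, G.CanDecrypt k j l t ω → l ≤ N := fun l hl =>
    (hN l).1 ((G.canDecrypt_iff hω k j l t).1 hl).1
  have hbdd : BddAbove {l | G.CanDecrypt k j l t ω} := ⟨N, hB⟩
  -- Decrypting nothing and decrypting only version 0 both give the value 0, the supremum of the
  -- empty set being 0 in ℕ; so only versions from 1 on matter.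
  have hV : ∀ d, G.nodeVersion k j t ω < d + 1 ↔ ∀ l, d + 1 ≤ l → ¬ G.CanDecrypt k j l t ω := by
    refine fun d => ⟨fun h l hl hd => ?_, fun h => ?_⟩
    · exact absurd (le_csSup hbdd hd) (not_le.2 (h.trans_le hl))
    · rcases Set.eq_empty_or_nonempty {l | G.CanDecrypt k j l t ω} with he | hne
      · rw [nodeVersion, he, csSup_empty]
        exact Nat.succ_pos d
      · by_contra! hc
        exact h _ hc (Nat.sSup_mem hne hbdd)
  have hVN : G.nodeVersion k j t ω ≤ N := Nat.lt_succ_iff.1 <|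
    (hV N).2 fun l hl hd => absurd (hB l hd) (by omega)
  have hout : ∀ d, (t : ℝ) ∈ NetworkData.outdated k j (G.data ω) (d + 1) ↔
      d < N ∧ G.nodeVersion k j t ω ≤ d := fun d => by
    simp only [NetworkData.outdated, Set.mem_ofPred_eq, NNReal.coe_le_coe]
    rw [hN, Nat.succ_le_iff, ← Nat.lt_succ_iff (n := d), Nat.succ_eq_add_one, hV]
    refine and_congr_right fun hd => ?_
    rw [← NNReal.coe_sub ((hN _).2 hd), Real.toNNReal_coe,
      NetworkData.undecrypted_shift k j _ _ ((hN _).2 hd)]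
    refine forall₂_congr fun l hl => ?_
    rw [G.canDecrypt_iff hω, not_and, not_lt]
  have hfil : (Finset.range n).filter
      (fun d => (t : ℝ) ∈ NetworkData.outdated k j (G.data ω) (d + 1))
      = Finset.Ico (G.nodeVersion k j t ω) N := by
    ext d
    simp only [Finset.mem_filter, Finset.mem_range, hout, Finset.mem_Ico]
    omega
  rw [hfil, Nat.card_Ico, Nat.cast_sub hVN, ← G.sourceVersion_eq hω hN]
  rfl

end HomogeneousNetwork

/-! ### The law of the inputs -/

lemma CountingPath.comap_coe {Ω ι : Type*} (f : Ω → ι → CountingPath) :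
    MeasurableSpace.comap f inferInstance
      = MeasurableSpace.comap (fun ω e => (f ω e : ℝ≥0 → ℕ)) inferInstance := by
  change MeasurableSpace.comap f (⨆ e, _) = MeasurableSpace.comap _ (⨆ e, _)
  rw [MeasurableSpace.comap_iSup, MeasurableSpace.comap_iSup]
  refine iSup_congr fun e => ?_
  rw [MeasurableSpace.comap_comp, MeasurableSpace.comap_comp]
  exact MeasurableSpace.comap_comp

lemma ProbabilityTheory.iIndepFun.map {Ω α ι : Type*} {β : ι → Type*} [MeasurableSpace Ω]
    [MeasurableSpace α] [∀ i, MeasurableSpace (β i)] {μ : Measure Ω} {f : ∀ i, α → β i} {g : Ω → α}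
    (h : iIndepFun (fun i ω => f i (g ω)) μ) (hf : ∀ i, Measurable (f i)) (hg : Measurable g) :
    iIndepFun f (μ.map g) := by
  rw [iIndepFun_iff_measure_inter_preimage_eq_mul] at h ⊢
  intro s t ht
  rw [Measure.map_apply hg (s.measurableSet_biInter fun i hi => hf i (ht i hi))]
  rw [Finset.prod_congr rfl fun i hi => Measure.map_apply hg (hf i (ht i hi))]
  rw [Set.preimage_iInter₂]
  exact h s ht

/-- The coordinate process is a Poisson counter under the law of the path of a Poisson counter. -/
lemma IsPoissonCounter.map_path {Ω : Type*} [MeasurableSpace Ω] {N : ℝ≥0 → Ω → ℕ} {r : ℝ≥0}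
    {μ : Measure Ω} (hN : IsPoissonCounter N r μ) :
    IsPoissonCounter (fun t (x : CountingPath) => x t) r (μ.map hN.path) where
  measurable := CountingPath.measurable_apply
  zero x := x.map_zero
  monotone x := x.monotone
  rightContinuous x := x.rightContinuous
  indepIncrements n t ht := (hN.indepIncrements n t ht).map
    (fun i => (CountingPath.measurable_apply _).sub (CountingPath.measurable_apply _))
    hN.measurable_path
  law_increment a b hab := by
    have hm : Measurable fun x : CountingPath => x b - x a :=
      (CountingPath.measurable_apply _).sub (CountingPath.measurable_apply _)
    refine ⟨hm.aemeasurable, ?_⟩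
    rw [Measure.map_map hm hN.measurable_path, ← (hN.law_increment a b hab).map_eq]
    rfl

namespace HomogeneousNetwork

variable {Ω : Type*} [MeasurableSpace Ω] {μ : Measure Ω} {m n : ℕ} {S : Finset (Fin m)}
  {lamS lamE : ℝ} (G : HomogeneousNetwork μ m n S lamS lamE)

lemma measurable_data : Measurable G.data := by
  refine Measurable.prodMk ?_ (Measurable.prodMk ?_ ?_)
  · exact measurable_pi_lambda _ fun l => (G.measurable_cycle l).real_toNNReal
  · exact measurable_pi_lambda _ fun l =>
      (measurable_of_countable (S ∪ ·)).comp (G.measurable_selected l)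
  · exact measurable_pi_lambda _ fun e => (G.poisson_activations e).measurable_path

lemma map_cycles : μ.map (fun ω => (G.data ω).1)
    = Measure.infinitePi fun _ => (expMeasure lamS).map Real.toNNReal := by
  have h : iIndepFun (fun l ω => (G.cycle l ω).toNNReal) μ :=
    G.indep_cycle.comp (fun _ => Real.toNNReal) fun _ => measurable_real_toNNReal
  have h1 := h.map_fun_eq_infinitePi_map fun l => (G.measurable_cycle l).real_toNNReal
  refine h1.trans (congrArg _ (funext fun l => ?_))
  rw [← (G.law_cycle l).map_eq, Measure.map_map measurable_real_toNNReal (G.measurable_cycle l)]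
  rfl

lemma map_keyHolders : μ.map (fun ω => (G.data ω).2.1)
    = Measure.infinitePi fun _ => keyHoldersLaw n S := by
  have h : iIndepFun (fun l ω => G.keyHolders l ω) μ :=
    G.indep_selected.comp (fun _ => (S ∪ ·)) fun _ => measurable_of_countable _
  have h1 := h.map_fun_eq_infinitePi_map fun l =>
    (measurable_of_countable (S ∪ ·)).comp (G.measurable_selected l)
  refine h1.trans (congrArg _ (funext fun l => ?_))
  rw [keyHoldersLaw, ← (G.law_selected l).map_eq,
    Measure.map_map (measurable_of_countable _) (G.measurable_selected l)]

/-- All edges have the same rate, which determines the law of a Poisson path, so the path of one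
reference edge supplies the common factor. -/
lemma map_paths [IsProbabilityMeasure μ] (e₀ : GossipEdge m) : μ.map (fun ω => (G.data ω).2.2)
    = Measure.pi fun _ => μ.map (G.poisson_activations e₀).path := by
  have h : iIndepFun (fun e => (G.poisson_activations e).path) μ := by
    have := G.indep_activations
    rw [iIndepFun_iff_iIndep] at this ⊢
    convert this using 2 with e
    exact MeasurableSpace.comap_comp
  have h1 := h.map_fun_eq_pi_map fun e =>
    (G.poisson_activations e).measurable_path.aemeasurable
  refine h1.trans (congrArg _ (funext fun e => ?_))
  exact (G.poisson_activations e).map_path_eq_map_path (G.poisson_activations e₀)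

lemma map_data [IsProbabilityMeasure μ] (e₀ : GossipEdge m) : μ.map G.data = NetworkData.law
    ((expMeasure lamS).map Real.toNNReal) (keyHoldersLaw n S)
    (μ.map (G.poisson_activations e₀).path) := by
  have hc : Measurable fun ω => (G.data ω).1 := G.measurable_data.fst
  have hK : Measurable fun ω => (G.data ω).2.1 := G.measurable_data.snd.fst
  have hp : Measurable fun ω => (G.data ω).2.2 := G.measurable_data.snd.snd
  have hf : Measurable fun c : ℕ → ℝ => fun l => (c l).toNNReal := by fun_prop
  have hg : Measurable fun A : ℕ → Finset (Fin m) => fun l => S ∪ A l :=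
    measurable_pi_lambda _ fun l => (measurable_of_countable (S ∪ ·)).comp (measurable_pi_apply l)
  have h1 : IndepFun (fun ω => (G.data ω).1) (fun ω => (G.data ω).2.1) μ :=
    G.indep_cycle_selected.comp hf hg
  have h2 : IndepFun (fun ω => ((G.data ω).1, (G.data ω).2.1)) (fun ω => (G.data ω).2.2) μ := by
    have h : IndepFun (fun ω => ((G.data ω).1, (G.data ω).2.1))
        (fun ω e t => G.activations e t ω) μ :=
      G.indep_source_activations.comp (hf.prodMap hg) measurable_id
    rw [IndepFun_iff_Indep] at h ⊢
    rwa [CountingPath.comap_coe]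
  have h3 := (indepFun_iff_map_prod_eq_prod_map_map (hc.prodMk hK).aemeasurable
    hp.aemeasurable).1 h2
  have : Nonempty (GossipEdge m) := ⟨e₀⟩
  have : IsProbabilityMeasure (μ.map (G.poisson_activations e₀).path) :=
    Measure.isProbabilityMeasure_map (G.poisson_activations e₀).measurable_path.aemeasurable
  have : IsProbabilityMeasure (μ.map fun ω => (G.data ω).2.2) :=
    Measure.isProbabilityMeasure_map hp.aemeasurable
  have : IsProbabilityMeasure (μ.map fun ω => (G.data ω).1) :=
    Measure.isProbabilityMeasure_map hc.aemeasurable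
  have : IsProbabilityMeasure (μ.map fun ω => (G.data ω).2.1) :=
    Measure.isProbabilityMeasure_map hK.aemeasurable
  rw [(indepFun_iff_map_prod_eq_prod_map_map hc.aemeasurable hK.aemeasurable).1 h1] at h3
  rw [NetworkData.law, ← G.map_cycles, ← G.map_keyHolders, ← G.map_paths e₀,
    ← (measurePreserving_prodAssoc _ _ _).map_eq, ← h3,
    Measure.map_map MeasurableEquiv.prodAssoc.measurable ((hc.prodMk hK).prodMk hp)]
  rfl

lemma ae_cycle_pos (hlamS : 0 < lamS) : ∀ᵐ ω ∂μ, ∀ l, 0 < G.cycle l ω := by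
  refine ae_all_iff.2 fun l => ?_
  refine ae_of_ae_map (G.measurable_cycle l).aemeasurable (p := fun c => 0 < c) ?_
  rw [(G.law_cycle l).map_eq]
  exact ae_pos_expMeasure hlamS

lemma ae_tendsto_updateTime [IsProbabilityMeasure μ] (hlamS : 0 < lamS) :
    ∀ᵐ ω ∂μ, Tendsto (fun l : ℕ => G.updateTime l ω / l) atTop (𝓝 (1 / lamS)) := by
  have h := strong_law_ae_real G.cycle ?_ (fun i j hij => G.indep_cycle.indepFun hij)
    fun i => (G.law_cycle i).identDistrib (G.law_cycle 0)
  · have hm : ∫ ω, G.cycle 0 ω ∂μ = 1 / lamS := by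
      rw [← integral_id_expMeasure hlamS, ← (G.law_cycle 0).map_eq,
        integral_map (f := fun c : ℝ => c) (G.measurable_cycle 0).aemeasurable
          aestronglyMeasurable_id]
    rwa [hm] at h
  · have := integrable_id_expMeasure hlamS
    rw [← (G.law_cycle 0).map_eq] at this
    exact this.comp_measurable (G.measurable_cycle 0)

end HomogeneousNetwork

/-! ### The version ages -/

lemma Finset.map_swap_eq {α : Type*} [DecidableEq α] {S : Finset α} {i j : α}
    (h : i ∈ S ↔ j ∈ S) : S.map (Equiv.swap i j).toEmbedding = S := by
  refine Finset.eq_of_subset_of_card_le (fun a ha => ?_) (Finset.card_map _).ge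
  obtain ⟨b, hb, rfl⟩ := Finset.mem_map.1 ha
  rw [Equiv.coe_toEmbedding, Equiv.swap_apply_def]
  split_ifs with h1 h2
  · exact h.1 (h1 ▸ hb)
  · exact h.2 (h2 ▸ hb)
  · exact hb

/-- Covers the case of an empty class (no subscribers or no nonsubscribers), where the value is
arbitrary and L is chosen to keep it within the bounds. -/
lemma exists_common_value {ι : Type*} {D : ι → ℝ} {p : ι → Prop} {L U : ℝ} (hLU : L ≤ U)
    (hD : ∀ i, L ≤ D i ∧ D i ≤ U) (h : ∀ i j, p i → p j → D i = D j) :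
    ∃ d, (∀ i, p i → D i = d) ∧ L ≤ d ∧ d ≤ U := by
  by_cases hp : ∃ i, p i
  · obtain ⟨i, hi⟩ := hp
    exact ⟨D i, fun j hj => h j i hj hi, hD i⟩
  · exact ⟨L, fun i hi => absurd ⟨i, hi⟩ hp, le_rfl, hLU⟩

lemma graphAverageAge_mem_Icc {s m : ℕ} (hm : 0 < m) (hsm : s ≤ m) {a b L U : ℝ}
    (ha : a ∈ Set.Icc L U) (hb : b ∈ Set.Icc L U) : graphAverageAge s m a b ∈ Set.Icc L U := by
  have hm' : (0 : ℝ) < m := by exact_mod_cast hm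
  have hs : (s : ℝ) ≤ m := by exact_mod_cast hsm
  exact convex_Icc L U ha hb (by positivity) (div_nonneg (sub_nonneg.2 hs) hm'.le)
    (by field_simp; ring)

theorem mainTheorem10 {Ω : Type*} [MeasurableSpace Ω] (μ : Measure Ω) [IsProbabilityMeasure μ]
    (k n s m : ℕ) (hkn : k < n) (hsn : s ≤ n) (hnm : n ≤ m) (hm : 2 ≤ m)
    (S : Finset (Fin m)) (hS : S.card = s)
    (lamS lamE : ℝ) (hlamS : 0 < lamS) (hlamE : 0 < lamE)
    (G : HomogeneousNetwork μ m n S lamS lamE) :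
    ∃ dSub dNon : ℝ,
      (∀ᵐ ω ∂μ,
        (∀ j ∈ S, IsTimeAverage (fun t => G.versionAge k j t ω) dSub) ∧
        (∀ j ∉ S, IsTimeAverage (fun t => G.versionAge k j t ω) dNon)) ∧
      ((m : ℝ) - 1) * lamS / lamE * ∑ i ∈ Finset.Icc (m - k) (m - 1), 1 / (i : ℝ)
        ≤ graphAverageAge s m dSub dNon ∧
      graphAverageAge s m dSub dNon
        ≤ ((m : ℝ) - 1) * lamS / lamE * ∑ i ∈ Finset.Icc (n - k) n, 1 / (i : ℝ) := by
  have hm1 : (0 : ℝ) < (m : ℝ) - 1 := by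
    have : (2 : ℝ) ≤ m := by exact_mod_cast hm
    linarith
  set r : ℝ≥0 := (lamE / ((m : ℝ) - 1)).toNNReal with hr_def
  have hr : 0 < r := Real.toNNReal_pos.2 (by positivity)
  have hr1 : 1 / (r : ℝ) = ((m : ℝ) - 1) / lamE := by
    rw [hr_def, Real.coe_toNNReal _ (by positivity), one_div_div]
  have e₀ : GossipEdge m := ⟨(⟨0, by omega⟩, ⟨1, by omega⟩), by simp⟩
  have hpath := (G.poisson_activations e₀).measurable_path
  set ρ := (expMeasure lamS).map Real.toNNReal with hρ_def
  set κ := keyHoldersLaw n S with hκ_def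
  set ν := μ.map (G.poisson_activations e₀).path with hν_def
  have hν : IsPoissonCounter (fun t (x : CountingPath) => x t) r ν :=
    (G.poisson_activations e₀).map_path
  have : IsProbabilityMeasure (expMeasure lamS) := isProbabilityMeasure_expMeasure hlamS
  have : IsProbabilityMeasure ρ :=
    Measure.isProbabilityMeasure_map measurable_real_toNNReal.aemeasurable
  have : IsProbabilityMeasure κ := isProbabilityMeasure_keyHoldersLaw hnm
  have : IsProbabilityMeasure ν := Measure.isProbabilityMeasure_map hpath.aemeasurable
  have hρ : ∀ᵐ c ∂ρ, 0 < c := by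
    rw [hρ_def, ae_map_iff measurable_real_toNNReal.aemeasurable measurableSet_Ioi]
    exact (ae_pos_expMeasure hlamS).mono fun c hc => Real.toNNReal_pos.2 hc
  have hκ : ∀ᵐ K ∂κ, K.card = n := ae_card_keyHoldersLaw (hS ▸ hsn)
  have hlaw : μ.map G.data = NetworkData.law ρ κ ν := G.map_data e₀
  -- Mean delay per version over mean cycle length.
  let D : Fin m → ℝ := fun j =>
    (∫⁻ x, NetworkData.delay k j x ∂NetworkData.law ρ κ ν).toReal / (1 / lamS)
  have hlim : ∀ᵐ ω ∂μ, ∀ j, IsTimeAverage (fun t => G.versionAge k j t ω) (D j) := by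
    have h1 : ∀ᵐ ω ∂μ, ∀ j,
        Tendsto (fun l : ℕ => (NetworkData.totalDelay k j l (G.data ω)).toReal / l) atTop
          (𝓝 (∫⁻ x, NetworkData.delay k j x ∂NetworkData.law ρ κ ν).toReal) := by
      refine ae_all_iff.2 fun j => ae_of_ae_map (p := fun x : NetworkData m =>
        Tendsto (fun l : ℕ => (NetworkData.totalDelay k j l x).toReal / l) atTop
          (𝓝 (∫⁻ x, NetworkData.delay k j x ∂NetworkData.law ρ κ ν).toReal))
        G.measurable_data.aemeasurable ?_
      rw [hlaw]
      exact NetworkData.ae_tendsto_totalDelay (hκ.mono fun K hK => hK.symm ▸ hkn) hr hρ hν j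
    filter_upwards [h1, G.ae_cycle_pos hlamS, G.ae_tendsto_updateTime hlamS] with ω h1 h2 h3 j
    refine (G.isAge_versionAge h2 k j).isTimeAverage (by positivity) ?_ (h1 j)
    simpa only [G.coe_time_data h2] using h3
  have hbounds : ∀ j, ((m : ℝ) - 1) * lamS / lamE *
        ∑ i ∈ Finset.Icc (m - k) (m - 1), 1 / (i : ℝ) ≤ D j ∧
      D j ≤ ((m : ℝ) - 1) * lamS / lamE * ∑ i ∈ Finset.Icc (n - k) n, 1 / (i : ℝ) := fun j => by
    have hu := NetworkData.lintegral_delay_le (ρ := ρ) hr hν hkn hκ j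
    have hl := (ENNReal.ofReal_le_iff_le_toReal (hu.trans_lt ENNReal.ofReal_lt_top).ne).1
      (NetworkData.le_lintegral_delay (ρ := ρ) (κ := κ) hr hν (hkn.trans_le hnm) j)
    replace hu := ENNReal.toReal_le_of_le_ofReal (by positivity) hu
    rw [hr1] at hu hl
    have hD : D j = lamS * (∫⁻ x, NetworkData.delay k j x ∂NetworkData.law ρ κ ν).toReal := by
      simp only [D]
      rw [div_div_eq_mul_div, div_one, mul_comm]
    have hfac : ∀ a : ℝ, ((m : ℝ) - 1) * lamS / lamE * a = lamS * (((m : ℝ) - 1) / lamE * a) :=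
      fun a => by ring
    rw [hD, hfac, hfac]
    exact ⟨mul_le_mul_of_nonneg_left hl hlamS.le, mul_le_mul_of_nonneg_left hu hlamS.le⟩
  have hsymm : ∀ i j, (i ∈ S ↔ j ∈ S) → D i = D j := fun i j hij => by
    have h := NetworkData.lintegral_delay_eq (ρ := ρ) (κ := κ) (ν := ν) k (Equiv.swap j i)
      (map_keyHoldersLaw n _ (by rw [Equiv.symm_swap]; exact Finset.map_swap_eq hij.symm)) j
    rw [Equiv.swap_apply_left] at h
    simp only [D, h]
  -- Consistency of the two bounds is read off from any node.
  have hLU := (hbounds ⟨0, by omega⟩).1.trans (hbounds ⟨0, by omega⟩).2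
  obtain ⟨dSub, hSub, hSub'⟩ := exists_common_value (p := fun i => i ∈ S) hLU hbounds
    fun i j hi hj => hsymm i j (iff_of_true hi hj)
  obtain ⟨dNon, hNon, hNon'⟩ := exists_common_value (p := fun i => i ∉ S) hLU hbounds
    fun i j hi hj => hsymm i j (iff_of_false hi hj)
  refine ⟨dSub, dNon, ?_, graphAverageAge_mem_Icc (by omega) (hsn.trans hnm) hSub' hNon'⟩
  filter_upwards [hlim] with ω hω
  exact ⟨fun j hj => hSub j hj ▸ hω j, fun j hj => hNon j hj ▸ hω j⟩
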